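/- A \emph{cq source} is a state $\omega^{XBR}=\sum_{x\in\mathcal X}p(x)\,|x\rangle\langle x|^X\otimes|\psi_x\rangle\langle\psi_x|^{BR}$, where $\mathcal X$ is a finite alphabet, $p$ a probability distribution on it, $B,R$ are finite-dimensional quantum systems and each $|\psi_x\rangle\in B\otimes R$ is a unit vector. Let $S(\rho)=-\operatorname{Tr}\rho\log_2\rho$, $I(A:C)=S(A)+S(C)-S(AC)$ and $I(A:D|C)=S(AC)+S(DC)-S(C)-S(ACD)$. For $\delta\ge 0$ define \[ I_\delta(\omega)=\sup_{\mathcal T} I(X:W)_\sigma \quad\text{s.t. } \mathcal T:B\to W \text{ is completely positive and trace preserving with } I(R:W|X)_\sigma\le\delta, \] where $\sigma^{XWR}=(\mathrm{id}_{XR}\otimes\mathcal T)\omega$ and $W$ ranges over all finite-dimensional quantum systems, and let $\widetilde I_0(\omega)=\lim_{\delta\searrow0}I_\delta(\omega)=\inf_{\delta>0}I_\delta(\omega)$. \textbf{Lemma.} Let $\omega,\omega_1,\omega_2$ be cq sources, and regard $\omega_1\otimes\omega_2$ as a cq source with systems $X_1X_2$, $B_1B_2$, $R_1R_2$, and $\omega^{\otimes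 n}$ as a cq source with systems $X^n,B^n,R^n$. \begin{enumerate} \item For every $\delta\ge0$, \[ I_\delta(\omega_1\otimes\omega_2)=\sup_{\substack{\delta_1,\delta_2\ge0\\ \delta_1+\delta_2=\delta}}\bigl(I_{\delta_1}(\omega_1)+I_{\delta_2}(\omega_2)\bigr). \] If $I_0(\omega_1)=\widetilde I_0(\omega_1)$ and $I_0(\omega_2)=\widetilde I_0(\omega_2)$, then the supremum is attained, i.e.\ it is a maximum, for every $\delta\ge0$. \item $I_{n\delta}(\omega^{\otimes n})=n\,I_\delta(\omega)$ for every integer $n\ge0$ and every $\delta\ge0$. \item $I_0(\omega_1\otimes\omega_2)=I_0(\omega_1)+I_0(\omega_2)$ and $\widetilde I_0(\omega_1\otimes\omega_2)=\widetilde I_0(\omega_1)+\widetilde I_0(\omega_2)$. \end{enumerate} -/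

import Mathlib

open scoped Kronecker ComplexOrder

namespace QInfo

noncomputable section

/-- The von Neumann entropy `S(ρ) = -Tr ρ log₂ ρ` of a density matrix, computed from its
eigenvalues (with `0 log 0 = 0`). Only Hermitian matrices matter; others get the value `0`. -/
def entropy {n : Type*} [Fintype n] [DecidableEq n] (ρ : Matrix n n ℂ) : ℝ :=
  open Classical in
  if h : ρ.IsHermitian then ∑ i, Real.negMulLog (h.eigenvalues i) / Real.log 2 else 0

/-- Partial trace over the second factor. -/
def traceRight {A C : Type*} [Fintype C] (ρ : Matrix (A × C) (A × C) ℂ) : Matrix A A ℂ :=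
  Matrix.of fun a a' => ∑ c, ρ (a, c) (a', c)

/-- Partial trace over the first factor. -/
def traceLeft {A C : Type*} [Fintype A] (ρ : Matrix (A × C) (A × C) ℂ) : Matrix C C ℂ :=
  Matrix.of fun c c' => ∑ a, ρ (a, c) (a, c')

/-- The marginal on the first two systems of a tripartite state (trace over the third). -/
def marginal12 {C A D : Type*} [Fintype D] (ρ : Matrix (C × A × D) (C × A × D) ℂ) :
    Matrix (C × A) (C × A) ℂ :=
  Matrix.of fun i j => ∑ d, ρ (i.1, i.2, d) (j.1, j.2, d)

/-- The marginal on the first and third systems of a tripartite state (trace over the second). -/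
def marginal13 {C A D : Type*} [Fintype A] (ρ : Matrix (C × A × D) (C × A × D) ℂ) :
    Matrix (C × D) (C × D) ℂ :=
  Matrix.of fun i j => ∑ a, ρ (i.1, a, i.2) (j.1, a, j.2)

/-- Quantum mutual information `I(A:C) = S(A) + S(C) - S(AC)`. -/
def mutualInfo {A C : Type*} [Fintype A] [DecidableEq A] [Fintype C] [DecidableEq C]
    (ρ : Matrix (A × C) (A × C) ℂ) : ℝ :=
  entropy (traceRight ρ) + entropy (traceLeft ρ) - entropy ρ

/-- Quantum conditional mutual information of a state on `C A D`, conditioned on the first system: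
`I(A:D|C) = S(CA) + S(CD) - S(C) - S(CAD)`. -/
def condMutualInfo {C A D : Type*} [Fintype C] [DecidableEq C] [Fintype A] [DecidableEq A]
    [Fintype D] [DecidableEq D] (ρ : Matrix (C × A × D) (C × A × D) ℂ) : ℝ :=
  entropy (marginal12 ρ) + entropy (marginal13 ρ) - entropy (traceRight ρ) - entropy ρ

/-- The map `id_A ⊗ T`. -/
def idTensor {B W : Type*} (A : Type*) (T : Matrix B B ℂ →ₗ[ℂ] Matrix W W ℂ)
    (ρ : Matrix (A × B) (A × B) ℂ) : Matrix (A × W) (A × W) ℂ :=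
  Matrix.of fun i j => T (Matrix.of fun b b' => ρ (i.1, b) (j.1, b')) i.2 j.2

/-- `T` is a quantum channel: completely positive and trace preserving. -/
structure IsCPTP {B W : Type*} [Fintype B] [Fintype W]
    (T : Matrix B B ℂ →ₗ[ℂ] Matrix W W ℂ) : Prop where
  completelyPositive : ∀ (k : ℕ) (ρ : Matrix (Fin k × B) (Fin k × B) ℂ),
    ρ.PosSemidef → (idTensor (Fin k) T ρ).PosSemidef
  tracePreserving : ∀ ρ : Matrix B B ℂ, (T ρ).trace = ρ.trace

/-- The state `(id_X ⊗ T ⊗ id_R) ρ` obtained by applying `T` to the middle system of `X B R`. -/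
def applyMiddle {X B R W : Type*} (T : Matrix B B ℂ →ₗ[ℂ] Matrix W W ℂ)
    (ρ : Matrix (X × B × R) (X × B × R) ℂ) : Matrix (X × W × R) (X × W × R) ℂ :=
  Matrix.of fun i j =>
    T (Matrix.of fun b b' => ρ (i.1, b, i.2.2) (j.1, b', j.2.2)) i.2.1 j.2.1

/-- The data of a classical-quantum source: a probability distribution `p` on a finite alphabet `X`
and, for each letter, a unit vector `ψ x` of the finite-dimensional space `ℂ^B ⊗ ℂ^R`. -/
structure CQSource (X B R : Type*) [Fintype X] [Fintype B] [Fintype R] where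
  p : X → ℝ
  p_nonneg : ∀ x, 0 ≤ p x
  p_sum : ∑ x, p x = 1
  ψ : X → B × R → ℂ
  ψ_norm : ∀ x, ∑ i, ‖ψ x i‖ ^ 2 = 1

namespace CQSource

section

variable {X B R : Type*} [Fintype X] [Fintype B] [Fintype R]

/-- The cq-state `ω^{XBR} = ∑ₓ p(x) |x⟩⟨x| ⊗ |ψₓ⟩⟨ψₓ|`. -/
def state [DecidableEq X] (ω : CQSource X B R) : Matrix (X × B × R) (X × B × R) ℂ :=
  ∑ x, (ω.p x : ℂ) • (Matrix.single x x (1 : ℂ) ⊗ₖ Matrix.vecMulVec (ω.ψ x) (star (ω.ψ x)))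

/-- `I_δ(ω)`: the supremum of `I(X:W)_σ` over all finite-dimensional systems `W` and all channels
`T : B → W` with `I(R:W|X)_σ ≤ δ`, where `σ^{XWR} = (id_{XR} ⊗ T) ω`. -/
def infoSup [DecidableEq X] [DecidableEq R] (ω : CQSource X B R) (δ : ℝ) : ℝ :=
  sSup {v : ℝ | ∃ (d : ℕ) (T : Matrix B B ℂ →ₗ[ℂ] Matrix (Fin d) (Fin d) ℂ), IsCPTP T ∧
    condMutualInfo (applyMiddle T ω.state) ≤ δ ∧
    v = mutualInfo (marginal12 (applyMiddle T ω.state))}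

/-- `Ĩ₀(ω) = inf_{δ > 0} I_δ(ω)`, which is also the limit of `I_δ(ω)` as `δ ↘ 0`. -/
def infoSupTilde [DecidableEq X] [DecidableEq R] (ω : CQSource X B R) : ℝ :=
  sInf (ω.infoSup '' Set.Ioi 0)

/-- The `n`-fold source `ω^{⊗n}`, with `X^n`, `B^n`, `R^n` indexed by functions on `Fin n`. -/
def pow (ω : CQSource X B R) (n : ℕ) : CQSource (Fin n → X) (Fin n → B) (Fin n → R) where
  p x := ∏ i, ω.p (x i)
  p_nonneg x := Finset.prod_nonneg fun i _ => ω.p_nonneg (x i)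
  p_sum := by
    classical
    rw [← Fintype.prod_sum (fun (_ : Fin n) x => ω.p x)]
    simp [ω.p_sum]
  ψ x br := ∏ i, ω.ψ (x i) (br.1 i, br.2 i)
  ψ_norm x := by
    classical
    have h := Fintype.prod_sum (fun (i : Fin n) (br : B × R) => ‖ω.ψ (x i) br‖ ^ 2)
    simp only [ω.ψ_norm, Finset.prod_const_one] at h
    rw [h]
    refine Fintype.sum_equiv (Equiv.arrowProdEquivProdArrow (Fin n) (fun _ => B) (fun _ => R)).symm
      _ _ fun br => ?_
    simp [norm_prod, Finset.prod_pow, Equiv.arrowProdEquivProdArrow]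

end

/-- The tensor product `ω₁ ⊗ ω₂`, a source with systems `X₁X₂`, `B₁B₂`, `R₁R₂`. -/
def prod {X₁ B₁ R₁ X₂ B₂ R₂ : Type*} [Fintype X₁] [Fintype B₁] [Fintype R₁]
    [Fintype X₂] [Fintype B₂] [Fintype R₂]
    (ω₁ : CQSource X₁ B₁ R₁) (ω₂ : CQSource X₂ B₂ R₂) :
    CQSource (X₁ × X₂) (B₁ × B₂) (R₁ × R₂) where
  p x := ω₁.p x.1 * ω₂.p x.2
  p_nonneg x := mul_nonneg (ω₁.p_nonneg _) (ω₂.p_nonneg _)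
  p_sum := by
    rw [Fintype.sum_prod_type, ← Finset.sum_mul_sum, ω₁.p_sum, ω₂.p_sum, one_mul]
  ψ x br := ω₁.ψ x.1 (br.1.1, br.2.1) * ω₂.ψ x.2 (br.1.2, br.2.2)
  ψ_norm x := by
    have h := Finset.sum_mul_sum Finset.univ Finset.univ
      (fun i => ‖ω₁.ψ x.1 i‖ ^ 2) (fun i => ‖ω₂.ψ x.2 i‖ ^ 2)
    rw [ω₁.ψ_norm, ω₂.ψ_norm, one_mul, ← Fintype.sum_prod_type'] at h
    rw [h]
    refine Fintype.sum_equiv (Equiv.prodProdProdComm B₁ B₂ R₁ R₂) _ _ fun br => ?_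
    simp [mul_pow, Equiv.prodProdProdComm]

theorem state_apply {X B R : Type*} [Fintype X] [Fintype B] [Fintype R] [DecidableEq X]
    (ω : CQSource X B R) (i j : X × B × R) :
    ω.state i j = if i.1 = j.1 then ω.p i.1 * (ω.ψ i.1 i.2 * star (ω.ψ i.1 j.2)) else 0 := by
  obtain ⟨x, br⟩ := i
  obtain ⟨y, br'⟩ := j
  simp only [state, Matrix.sum_apply, Matrix.smul_apply, Matrix.kroneckerMap_apply,
    Matrix.vecMulVec_apply, Matrix.single_apply, smul_eq_mul, Pi.star_apply]
  rw [Finset.sum_eq_single x]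
  · by_cases h : x = y <;> simp [h]
  · intro z _ hz
    simp [hz]
  · simp

/-- The density matrix of `ω₁ ⊗ ω₂` is the tensor product of the density matrices. -/
theorem prod_state_apply {X₁ B₁ R₁ X₂ B₂ R₂ : Type*} [Fintype X₁] [Fintype B₁] [Fintype R₁]
    [Fintype X₂] [Fintype B₂] [Fintype R₂] [DecidableEq X₁] [DecidableEq X₂]
    (ω₁ : CQSource X₁ B₁ R₁) (ω₂ : CQSource X₂ B₂ R₂)
    (i j : (X₁ × X₂) × (B₁ × B₂) × (R₁ × R₂)) :
    (ω₁.prod ω₂).state i j =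
      ω₁.state (i.1.1, i.2.1.1, i.2.2.1) (j.1.1, j.2.1.1, j.2.2.1) *
        ω₂.state (i.1.2, i.2.1.2, i.2.2.2) (j.1.2, j.2.1.2, j.2.2.2) := by
  simp only [state_apply, prod, Prod.ext_iff]
  by_cases h₁ : i.1.1 = j.1.1 <;> by_cases h₂ : i.1.2 = j.1.2 <;> simp [h₁, h₂]
  ring

/-- The density matrix of `ω^{⊗n}` is the `n`-fold tensor power of the density matrix of `ω`. -/
theorem pow_state_apply {X B R : Type*} [Fintype X] [Fintype B] [Fintype R] [DecidableEq X]
    (ω : CQSource X B R) (n : ℕ) (i j : (Fin n → X) × (Fin n → B) × (Fin n → R)) :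
    (ω.pow n).state i j =
      ∏ k, ω.state (i.1 k, i.2.1 k, i.2.2 k) (j.1 k, j.2.1 k, j.2.2 k) := by
  simp only [state_apply, pow]
  by_cases h : i.1 = j.1
  · simp [h, Finset.prod_mul_distrib]
  · obtain ⟨k, hk⟩ := Function.ne_iff.mp h
    rw [if_neg h]
    exact (Finset.prod_eq_zero (Finset.mem_univ k) (if_neg hk)).symm

end CQSource

end

end QInfo

namespace QInfo

open Matrix

/-! ### Entropy from arbitrary diagonalisations, under products and direct sums. -/

section Entropy

variable {n m : Type*} [Fintype n] [DecidableEq n] [Fintype m] [DecidableEq m]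

/-! Superadditivity is the easy half of the product formula. For the tensor product of two channels
both `info` and `disturbance` are sums, so budgets `δ₁` and `δ₂` combine to `δ₁ + δ₂`
(`infoSup_add_le_infoSup_prod`).

The converse splits one channel `T : B₁B₂ → W` in two (`split_channel`). `leftMap` feeds the `B₂`
part of `ω₂` into `T` and gives `B₁ → W`; `rightMap` prepares `ω₁` locally and gives `B₂ → X₁R₁W`.
The output state on `X₁X₂WR₁R₂` is the same in both cases, and independence of the two sources gives
I(R₁R₂:W|X₁X₂) = I(R₁:W|X₁) + I(R₂:X₁R₁W|X₂) + I(R₁:X₂|X₁W), I(X₁X₂:W) = I(X₁:W) + I(X₂:X₁R₁W) −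
I(R₁:X₂|X₁W). The common last term is nonnegative by strong subadditivity. The two induced channels
thus share the disturbance budget and carry at least as much information.

The rest is analysis of `infoSup`. It is monotone and, by mixing channels with a flag in the output,
concave. Concavity gives continuity on the open half-line. Equality with `infoSupTilde` supplies
continuity at 0, so the supremum over splittings is attained by compactness. For powers, induction
and concavity make the equal splitting optimal.

Strong subadditivity (`ssa`) is derived from monotonicity of relative entropy under partial trace
(`divSum_mono`). The quantities obtained by differentiating an interpolating function are suprema of
quadratic forms, and a partial trace can only decrease these suprema. -/

theorem entropy_eq_roots {ρ : Matrix n n ℂ} (h : ρ.IsHermitian) :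
    entropy ρ = (ρ.charpoly.roots.map fun z => Real.negMulLog z.re / Real.log 2).sum := by
  rw [entropy, dif_pos h, h.roots_charpoly_eq_eigenvalues]
  simp only [Multiset.map_map]
  rfl

/-- `ρ = U diag(d) U*` with `U` unitary. -/
structure IsSpectral (ρ U : Matrix n n ℂ) (d : n → ℝ) : Prop where
  unitary : Uᴴ * U = 1
  eq : ρ = U * diagonal (fun i => (d i : ℂ)) * Uᴴ

namespace IsSpectral

variable {ρ U : Matrix n n ℂ} {d : n → ℝ}

theorem unitary' (h : IsSpectral ρ U d) : U * Uᴴ = 1 := mul_eq_one_comm.mp h.unitary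

theorem conj_eq (h : IsSpectral ρ U d) : Uᴴ * ρ * U = diagonal (fun i => (d i : ℂ)) := by
  rw [h.eq]
  simp only [Matrix.mul_assoc, h.unitary, Matrix.mul_one]
  rw [← Matrix.mul_assoc, h.unitary, Matrix.one_mul]

theorem isHermitian (h : IsSpectral ρ U d) : ρ.IsHermitian := by
  rw [h.eq]
  simp [Matrix.IsHermitian, conjTranspose_mul, Matrix.mul_assoc, diagonal_conjTranspose]
  congr 3
  funext i
  simp

theorem charpoly (h : IsSpectral ρ U d) :
    ρ.charpoly = ∏ i, (Polynomial.X - Polynomial.C (d i : ℂ)) := by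
  rw [h.eq, charpoly_mul_comm, ← Matrix.mul_assoc, h.unitary, Matrix.one_mul, charpoly_diagonal]

/-- Any diagonalisation may be used, since the roots of the characteristic polynomial forget the
order of the eigenvalues. Products, multiples and shifts can thus be computed on explicit spectra.
-/
theorem entropy_eq (h : IsSpectral ρ U d) :
    entropy ρ = ∑ i, Real.negMulLog (d i) / Real.log 2 := by
  rw [entropy_eq_roots h.isHermitian, h.charpoly, Polynomial.roots_prod _ _
    (Finset.prod_ne_zero_iff.mpr fun i _ => Polynomial.X_sub_C_ne_zero _)]
  simp

theorem trace_eq (h : IsSpectral ρ U d) : ρ.trace = ((∑ i, d i : ℝ) : ℂ) := by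
  rw [h.eq, trace_mul_comm, ← Matrix.mul_assoc, h.unitary, Matrix.one_mul, trace_diagonal]
  simp

theorem smul (h : IsSpectral ρ U d) (a : ℝ) : IsSpectral ((a : ℂ) • ρ) U (fun i => a * d i) := by
  refine ⟨h.unitary, ?_⟩
  rw [h.eq, ← Matrix.smul_mul, ← Matrix.mul_smul, ← diagonal_smul]
  congr 3
  ext i
  simp

theorem add_smul_one (h : IsSpectral ρ U d) (a : ℝ) :
    IsSpectral (ρ + (a : ℂ) • 1) U (fun i => d i + a) := by
  refine ⟨h.unitary, ?_⟩
  have : diagonal (fun i => ((d i + a : ℝ) : ℂ)) = diagonal (fun i => (d i : ℂ)) + (a : ℂ) • 1 := by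
    rw [← diagonal_one, ← diagonal_smul, diagonal_add]
    congr 1
    ext i
    simp
  rw [this, Matrix.mul_add, Matrix.add_mul, ← h.eq]
  simp [h.unitary']

theorem kronecker {σ V : Matrix m m ℂ} {e : m → ℝ} (h : IsSpectral ρ U d) (k : IsSpectral σ V e) :
    IsSpectral (ρ ⊗ₖ σ) (U ⊗ₖ V) (fun i => d i.1 * e i.2) := by
  refine ⟨?_, ?_⟩
  · rw [conjTranspose_kronecker, ← mul_kronecker_mul, h.unitary, k.unitary, one_kronecker_one]
  · have := diagonal_kronecker_diagonal (fun i => (d i : ℂ)) (fun i => (e i : ℂ))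
    simp only [Complex.ofReal_mul]
    rw [← this, conjTranspose_kronecker, ← mul_kronecker_mul, ← mul_kronecker_mul, ← h.eq, ← k.eq]

/-- The matrix of overlaps of two eigenbases is unitary. -/
theorem overlap {σ V : Matrix n n ℂ} {e : n → ℝ} (h : IsSpectral ρ U d) (k : IsSpectral σ V e) :
    (Uᴴ * V)ᴴ * (Uᴴ * V) = 1 := by
  rw [conjTranspose_mul, conjTranspose_conjTranspose, Matrix.mul_assoc, ← Matrix.mul_assoc U,
    h.unitary', Matrix.one_mul, k.unitary]

end IsSpectral

theorem isSpectral_one : IsSpectral (1 : Matrix n n ℂ) 1 (fun _ => 1) :=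
  ⟨by simp, by simp⟩

theorem isSpectral_of_isHermitian {ρ : Matrix n n ℂ} (h : ρ.IsHermitian) :
    IsSpectral ρ h.eigenvectorUnitary h.eigenvalues := by
  refine ⟨?_, ?_⟩
  · exact Unitary.coe_star_mul_self h.eigenvectorUnitary
  · have := h.spectral_theorem
    rw [Unitary.conjStarAlgAut_apply] at this
    exact this

/-- `A * B` and `B * A` have the same characteristic polynomial up to a power of the variable, and
zero eigenvalues contribute nothing to the entropy. -/
theorem entropy_mul_comm (A : Matrix n m ℂ) (B : Matrix m n ℂ) (h₁ : (A * B).IsHermitian)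
    (h₂ : (B * A).IsHermitian) : entropy (A * B) = entropy (B * A) := by
  rw [entropy_eq_roots h₁, entropy_eq_roots h₂]
  have := congrArg Polynomial.roots (charpoly_mul_comm' A B)
  rw [Polynomial.roots_mul (mul_ne_zero (pow_ne_zero _ Polynomial.X_ne_zero)
      (charpoly_monic _).ne_zero), Polynomial.roots_mul (mul_ne_zero (pow_ne_zero _
      Polynomial.X_ne_zero) (charpoly_monic _).ne_zero)] at this
  have := congrArg (fun s => (s.map fun z : ℂ => Real.negMulLog z.re / Real.log 2).sum) this
  simpa [Multiset.map_nsmul, Multiset.sum_nsmul] using this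

theorem entropy_reindex {ρ : Matrix n n ℂ} {σ : Matrix m m ℂ} (e : n ≃ m)
    (h : ∀ i j, ρ i j = σ (e i) (e j)) (hσ : σ.IsHermitian) : entropy ρ = entropy σ := by
  have : ρ = σ.submatrix e e := by ext i j; exact h i j
  have hρ : ρ.IsHermitian := this ▸ hσ.submatrix e
  rw [entropy_eq_roots hρ, entropy_eq_roots hσ, this]
  have := charpoly_reindex e.symm σ
  simp only [reindex_apply, Equiv.symm_symm] at this
  rw [this]

theorem entropy_kronecker {ρ : Matrix n n ℂ} {σ : Matrix m m ℂ} (hρ : ρ.IsHermitian)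
    (hσ : σ.IsHermitian) (tρ : ρ.trace = 1) (tσ : σ.trace = 1) :
    entropy (ρ ⊗ₖ σ) = entropy ρ + entropy σ := by
  have h := isSpectral_of_isHermitian hρ
  have k := isSpectral_of_isHermitian hσ
  have h1 : ∑ i, hρ.eigenvalues i = 1 := by exact_mod_cast h.trace_eq.symm.trans tρ
  have k1 : ∑ i, hσ.eigenvalues i = 1 := by exact_mod_cast k.trace_eq.symm.trans tσ
  rw [(h.kronecker k).entropy_eq, h.entropy_eq, k.entropy_eq, Fintype.sum_prod_type]
  simp only [Real.negMulLog_mul, add_div, Finset.sum_add_distrib]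
  congr 1
  · rw [Finset.sum_congr rfl]
    intro i _
    simp_rw [mul_div_assoc]
    rw [← Finset.sum_mul, k1, one_mul]
  · simp_rw [mul_div_assoc]
    simp_rw [← Finset.mul_sum]
    rw [← Finset.sum_mul, h1, one_mul]

theorem entropy_of_mul {k : Type*} [Fintype k] [DecidableEq k] {τ : Matrix k k ℂ}
    {ρ : Matrix n n ℂ} {σ : Matrix m m ℂ} (e : k ≃ n × m)
    (h : ∀ i j, τ i j = ρ (e i).1 (e j).1 * σ (e i).2 (e j).2) (hρ : ρ.IsHermitian)
    (hσ : σ.IsHermitian) (tρ : ρ.trace = 1) (tσ : σ.trace = 1) :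
    entropy τ = entropy ρ + entropy σ := by
  rw [← entropy_kronecker hρ hσ tρ tσ]
  refine entropy_reindex e (fun i j => by simp [h]) ?_
  rw [Matrix.IsHermitian, conjTranspose_kronecker, hρ.eq, hσ.eq]

theorem entropy_smul {ρ : Matrix n n ℂ} (hρ : ρ.IsHermitian) (tρ : ρ.trace = 1) (a : ℝ) :
    entropy ((a : ℂ) • ρ) = a * entropy ρ + Real.negMulLog a / Real.log 2 := by
  have h := isSpectral_of_isHermitian hρ
  have h1 : ∑ i, hρ.eigenvalues i = 1 := by exact_mod_cast h.trace_eq.symm.trans tρ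
  rw [(h.smul a).entropy_eq, h.entropy_eq]
  simp only [Real.negMulLog_mul, add_div, Finset.sum_add_distrib, mul_div_assoc]
  rw [← Finset.sum_mul, h1, Finset.mul_sum]
  ring

theorem entropy_fromBlocks {ρ : Matrix n n ℂ} {σ : Matrix m m ℂ} (hρ : ρ.IsHermitian)
    (hσ : σ.IsHermitian) : entropy (fromBlocks ρ 0 0 σ) = entropy ρ + entropy σ := by
  have : (fromBlocks ρ 0 0 σ).IsHermitian := by
    simp [Matrix.IsHermitian, fromBlocks_conjTranspose, hρ.eq, hσ.eq]
  rw [entropy_eq_roots hρ, entropy_eq_roots hσ, entropy_eq_roots this, charpoly_fromBlocks_zero₁₂,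
    Polynomial.roots_mul (mul_ne_zero (charpoly_monic _).ne_zero (charpoly_monic _).ne_zero)]
  simp

/-- The last bracket is the entropy of the flag that selects the block. It does not depend on `ρ` or
`σ`, so it cancels in differences of entropies. -/
theorem entropy_of_sum {k : Type*} [Fintype k] [DecidableEq k] {τ : Matrix k k ℂ}
    {ρ : Matrix n n ℂ} {σ : Matrix m m ℂ} (e : k ≃ n ⊕ m) (a b : ℝ)
    (h : ∀ i j, τ i j = fromBlocks ((a : ℂ) • ρ) 0 0 ((b : ℂ) • σ) (e i) (e j))
    (hρ : ρ.IsHermitian) (hσ : σ.IsHermitian) (tρ : ρ.trace = 1) (tσ : σ.trace = 1) :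
    entropy τ = a * entropy ρ + b * entropy σ +
      (Real.negMulLog a / Real.log 2 + Real.negMulLog b / Real.log 2) := by
  have h1 : ((a : ℂ) • ρ).IsHermitian := by simp [Matrix.IsHermitian, hρ.eq]
  have h2 : ((b : ℂ) • σ).IsHermitian := by simp [Matrix.IsHermitian, hσ.eq]
  rw [entropy_reindex e h (by simp only [Matrix.IsHermitian, fromBlocks_conjTranspose, h1.eq, h2.eq]; simp),
    entropy_fromBlocks h1 h2, entropy_smul hρ tρ, entropy_smul hσ tσ]
  ring

theorem entropy_subsingleton [Subsingleton n] {ρ : Matrix n n ℂ} (h : ρ.IsHermitian)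
    (tρ : ρ.trace = 1) : entropy ρ = 0 := by
  have s := isSpectral_of_isHermitian h
  have h1 : ∑ i, h.eigenvalues i = 1 := by exact_mod_cast s.trace_eq.symm.trans tρ
  rw [s.entropy_eq]
  refine Finset.sum_eq_zero fun i _ => ?_
  rw [Fintype.sum_subsingleton _ i] at h1
  simp [h1]

end Entropy
end QInfo

namespace QInfo

open Matrix Filter Topology

/-! ### Monotonicity of relative entropy through a variational formula. -/

section RelativeEntropy

variable {n : Type*} [Fintype n]

/-- The concave quadratic form in `X` whose supremum is `⟨σ, (L_ρ + t R_σ)⁻¹ σ⟩`. -/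
noncomputable def quad (ρ σ : Matrix n n ℂ) (t : ℝ) (X : Matrix n n ℂ) : ℝ :=
  2 * (Xᴴ * σ).trace.re - (X * Xᴴ * ρ).trace.re - t * (Xᴴ * X * σ).trace.re

/-- The supremum of `quad`, in terms of eigenvalues. -/
noncomputable def quadSup (u : Matrix n n ℂ) (l m : n → ℝ) (t : ℝ) : ℝ :=
  ∑ i, ∑ j, ‖u i j‖ ^ 2 * (m j ^ 2 / (l i + t * m j))

/-- A primitive, in the parameter `t`, of the integrand of the integral representation of the
relative entropy. -/
noncomputable def divPrim (u : Matrix n n ℂ) (l m : n → ℝ) (t : ℝ) : ℝ :=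
  ∑ i, ∑ j, ‖u i j‖ ^ 2 * (l i * (Real.log (1 + t) + Real.log (l i) - Real.log (l i + t * m j)))

/-- The relative entropy (in nats) in terms of eigenvalues. -/
noncomputable def divSum (u : Matrix n n ℂ) (l m : n → ℝ) : ℝ :=
  ∑ i, ∑ j, ‖u i j‖ ^ 2 * (l i * (Real.log (l i) - Real.log (m j)))

theorem divPrim_zero (u : Matrix n n ℂ) (l m : n → ℝ) : divPrim u l m 0 = 0 := by
  simp [divPrim]

theorem tendsto_divPrim {l m : n → ℝ} (u : Matrix n n ℂ) (hl : ∀ i, 0 < l i) (hm : ∀ i, 0 < m i) :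
    Tendsto (divPrim u l m) atTop (𝓝 (divSum u l m)) := by
  refine tendsto_finsetSum _ fun i _ => tendsto_finsetSum _ fun j _ =>
    Tendsto.const_mul _ (Tendsto.const_mul _ ?_)
  have h : Tendsto (fun t : ℝ => (l i / (1 + t) + t / (1 + t) * m j)) atTop (𝓝 (0 + 1 * m j)) := by
    have h0 : Tendsto (fun t : ℝ => 1 + t) atTop atTop := tendsto_atTop_add_const_left _ _ tendsto_id
    refine (h0.const_div_atTop _).add (Tendsto.mul_const _ ?_)
    have : Tendsto (fun t : ℝ => 1 - 1 / (1 + t)) atTop (𝓝 (1 - 0)) :=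
      (h0.const_div_atTop _).const_sub _
    rw [sub_zero] at this
    refine this.congr' ?_
    filter_upwards [eventually_ge_atTop 0] with t ht
    field_simp
    ring
  rw [zero_add, one_mul] at h
  refine ((h.log (hm j).ne').const_sub (Real.log (l i))).congr' ?_
  filter_upwards [eventually_ge_atTop 0] with t ht
  have h1 : 0 < l i + t * m j := by have := hl i; have := hm j; positivity
  have : l i / (1 + t) + t / (1 + t) * m j = (l i + t * m j) / (1 + t) := by ring
  rw [this, Real.log_div h1.ne' (by positivity)]
  ring

variable [DecidableEq n] {ρ σ U V : Matrix n n ℂ} {l m : n → ℝ}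

/-- In the two eigenbases the form decouples into one scalar concave parabola per matrix entry, so
it can be maximised entry by entry. -/
theorem quad_conj (hρ : IsSpectral ρ U l) (hσ : IsSpectral σ V m) (t : ℝ) (Y : Matrix n n ℂ) :
    quad ρ σ t (U * Y * Vᴴ) =
      ∑ i, ∑ j, (2 * m j * (star (Y i j) * (Uᴴ * V) i j).re - (l i + t * m j) * ‖Y i j‖ ^ 2) := by
  have e1 : ((U * Y * Vᴴ)ᴴ * σ).trace = ∑ i, ∑ j, star (Y i j) * (Uᴴ * V) i j * m j := by
    have : ((U * Y * Vᴴ)ᴴ * σ).trace = (Yᴴ * (Uᴴ * V) * diagonal (fun i => (m i : ℂ))).trace := by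
      rw [hσ.eq]
      simp only [conjTranspose_mul, conjTranspose_conjTranspose]
      rw [← Matrix.mul_assoc, trace_mul_comm, ← Matrix.mul_assoc, ← Matrix.mul_assoc,
        ← Matrix.mul_assoc, ← Matrix.mul_assoc, hσ.unitary, Matrix.one_mul, Matrix.mul_assoc Yᴴ]
    rw [this, Finset.sum_comm, trace]
    simp only [diag_apply, mul_diagonal]
    refine Finset.sum_congr rfl fun j _ => ?_
    rw [Matrix.mul_apply, Finset.sum_mul]
    rfl
  have e2 : ((U * Y * Vᴴ) * (U * Y * Vᴴ)ᴴ * ρ).trace = ∑ i, ∑ j, (l i : ℂ) * ‖Y i j‖ ^ 2 := by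
    have : ((U * Y * Vᴴ) * (U * Y * Vᴴ)ᴴ * ρ).trace =
        (diagonal (fun i => (l i : ℂ)) * (Y * Yᴴ)).trace := by
      rw [trace_mul_comm _ (Y * Yᴴ), ← hρ.conj_eq]
      simp only [conjTranspose_mul, conjTranspose_conjTranspose]
      rw [← Matrix.mul_assoc (Y * Yᴴ), trace_mul_comm _ U]
      congr 1
      simp only [Matrix.mul_assoc]
      rw [← Matrix.mul_assoc Vᴴ V, hσ.unitary, Matrix.one_mul]
    rw [this, trace]
    simp only [diag_apply, diagonal_mul]
    refine Finset.sum_congr rfl fun i _ => ?_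
    rw [Matrix.mul_apply, Finset.mul_sum]
    refine Finset.sum_congr rfl fun j _ => ?_
    rw [conjTranspose_apply, ← Complex.mul_conj']
    rfl
  have e3 : ((U * Y * Vᴴ)ᴴ * (U * Y * Vᴴ) * σ).trace = ∑ i, ∑ j, (m j : ℂ) * ‖Y i j‖ ^ 2 := by
    have : ((U * Y * Vᴴ)ᴴ * (U * Y * Vᴴ) * σ).trace =
        (diagonal (fun i => (m i : ℂ)) * (Yᴴ * Y)).trace := by
      rw [trace_mul_comm _ (Yᴴ * Y), ← hσ.conj_eq]
      simp only [conjTranspose_mul, conjTranspose_conjTranspose]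
      rw [← Matrix.mul_assoc (Yᴴ * Y), trace_mul_comm _ V]
      congr 1
      simp only [Matrix.mul_assoc]
      rw [← Matrix.mul_assoc Uᴴ U, hρ.unitary, Matrix.one_mul]
    rw [this, trace, Finset.sum_comm]
    simp only [diag_apply, diagonal_mul]
    refine Finset.sum_congr rfl fun i _ => ?_
    rw [Matrix.mul_apply, Finset.mul_sum]
    refine Finset.sum_congr rfl fun j _ => ?_
    rw [conjTranspose_apply, ← Complex.conj_mul']
    rfl
  rw [quad, e1, e2, e3]
  simp only [Complex.re_sum, Finset.mul_sum, ← Finset.sum_sub_distrib]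
  refine Finset.sum_congr rfl fun i _ => Finset.sum_congr rfl fun j _ => ?_
  rw [Complex.re_mul_ofReal, Complex.re_ofReal_mul, Complex.re_ofReal_mul]
  norm_cast
  ring

theorem quad_le_quadSup (hρ : IsSpectral ρ U l) (hσ : IsSpectral σ V m) (hl : ∀ i, 0 < l i)
    (hm : ∀ i, 0 < m i) {t : ℝ} (ht : 0 ≤ t) (X : Matrix n n ℂ) :
    quad ρ σ t X ≤ quadSup (Uᴴ * V) l m t := by
  have hX : X = U * (Uᴴ * X * V) * Vᴴ := by
    simp only [Matrix.mul_assoc, hσ.unitary', Matrix.mul_one]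
    rw [← Matrix.mul_assoc, hρ.unitary', Matrix.one_mul]
  rw [hX, quad_conj hρ hσ, quadSup]
  refine Finset.sum_le_sum fun i _ => Finset.sum_le_sum fun j _ => ?_
  generalize (Uᴴ * X * V) i j = y
  generalize (Uᴴ * V) i j = u
  have ha : 0 < l i + t * m j := by have := hl i; have := hm j; positivity
  rw [mul_div_assoc', le_div_iff₀ ha]
  simp only [Complex.sq_norm, Complex.normSq_apply, Complex.star_def, Complex.mul_re,
    Complex.conj_re, Complex.conj_im]
  nlinarith [sq_nonneg ((l i + t * m j) * y.re - m j * u.re),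
    sq_nonneg ((l i + t * m j) * y.im - m j * u.im)]

theorem exists_quad_eq_quadSup (hρ : IsSpectral ρ U l) (hσ : IsSpectral σ V m) (hl : ∀ i, 0 < l i)
    (hm : ∀ i, 0 < m i) {t : ℝ} (ht : 0 ≤ t) :
    ∃ X, quad ρ σ t X = quadSup (Uᴴ * V) l m t := by
  -- Each entry sits at the vertex of its parabola.
  refine ⟨U * (Matrix.of fun i j => ((m j / (l i + t * m j) : ℝ) : ℂ) * (Uᴴ * V) i j) * Vᴴ, ?_⟩
  rw [quad_conj hρ hσ, quadSup]
  refine Finset.sum_congr rfl fun i _ => Finset.sum_congr rfl fun j _ => ?_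
  rw [of_apply]
  generalize (Uᴴ * V) i j = u
  have ha : 0 < l i + t * m j := by have := hl i; have := hm j; positivity
  simp only [Complex.sq_norm, Complex.normSq_apply, Complex.star_def, Complex.mul_re,
    Complex.conj_re, Complex.conj_im, Complex.mul_im, Complex.ofReal_re, Complex.ofReal_im]
  generalize l i + t * m j = a at ha ⊢
  field_simp
  ring

theorem sum_norm_sq_row {u : Matrix n n ℂ} (hu : u * uᴴ = 1) (i : n) : ∑ j, ‖u i j‖ ^ 2 = 1 := by
  have := congrFun (congrFun hu i) i
  rw [Matrix.mul_apply, one_apply_eq] at this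
  have h2 : ((∑ j, ‖u i j‖ ^ 2 : ℝ) : ℂ) = 1 := by
    rw [← this]
    push_cast
    refine Finset.sum_congr rfl fun j _ => ?_
    rw [conjTranspose_apply, ← Complex.mul_conj']
    rfl
  exact_mod_cast h2

theorem sum_norm_sq_col {u : Matrix n n ℂ} (hu : uᴴ * u = 1) (j : n) : ∑ i, ‖u i j‖ ^ 2 = 1 := by
  have := sum_norm_sq_row (u := uᴴ) (by simpa using hu) j
  simpa using this

/-- The identity l·m/(l + t·m) = m − t·m²/(l + t·m) isolates `quadSup`. What remains depends on the
traces only, because the squared moduli of a unitary matrix form a doubly stochastic matrix. -/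
theorem hasDerivAt_divPrim {u : Matrix n n ℂ} (hu : uᴴ * u = 1) (hl : ∀ i, 0 < l i)
    (hm : ∀ i, 0 < m i) {t : ℝ} (ht : 0 ≤ t) :
    HasDerivAt (divPrim u l m)
      ((∑ i, l i) / (1 + t) - ∑ j, m j + t * quadSup u l m t) t := by
  have e : (∑ i, l i) / (1 + t) - ∑ j, m j + t * quadSup u l m t =
      ∑ i, ∑ j, ‖u i j‖ ^ 2 * (l i * (1 / (1 + t) + 0 - m j / (l i + t * m j))) := by
    have h1 : ∑ i, l i = ∑ i, ∑ j, ‖u i j‖ ^ 2 * l i := by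
      refine Finset.sum_congr rfl fun i _ => ?_
      rw [← Finset.sum_mul, sum_norm_sq_row (mul_eq_one_comm.mp hu), one_mul]
    have h2 : ∑ j, m j = ∑ i, ∑ j, ‖u i j‖ ^ 2 * m j := by
      rw [Finset.sum_comm]
      refine Finset.sum_congr rfl fun i _ => ?_
      rw [← Finset.sum_mul, sum_norm_sq_col hu, one_mul]
    rw [h1, h2, quadSup]
    simp only [Finset.sum_div, Finset.mul_sum, ← Finset.sum_sub_distrib, ← Finset.sum_add_distrib]
    refine Finset.sum_congr rfl fun i _ => Finset.sum_congr rfl fun j _ => ?_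
    have h1 : 0 < l i + t * m j := by have := hl i; have := hm j; positivity
    field_simp
    ring
  rw [e]
  refine HasDerivAt.fun_sum fun i _ => HasDerivAt.fun_sum fun j _ =>
    HasDerivAt.const_mul _ (HasDerivAt.const_mul _ (((?_ : HasDerivAt _ _ _).add
      (hasDerivAt_const _ _)).sub ?_))
  · exact ((hasDerivAt_id t).const_add 1).log (by simp only [id]; positivity)
  · have h1 : 0 < l i + t * m j := by have := hl i; have := hm j; positivity
    have := (((hasDerivAt_id t).mul_const (m j)).const_add (l i)).log (by simpa using h1.ne')
    simpa using this

/-- Monotonicity of the relative entropy under a trace-preserving map `ρ ↦ ρ'`, `σ ↦ σ'` whose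
adjoint is a homomorphism. -/
theorem divSum_mono {n' : Type*} [Fintype n'] [DecidableEq n'] {ρ' σ' U' V' : Matrix n' n' ℂ}
    {l' m' : n' → ℝ} (hρ : IsSpectral ρ U l) (hσ : IsSpectral σ V m) (hl : ∀ i, 0 < l i)
    (hm : ∀ i, 0 < m i) (hρ' : IsSpectral ρ' U' l') (hσ' : IsSpectral σ' V' m')
    (hl' : ∀ i, 0 < l' i) (hm' : ∀ i, 0 < m' i)
    (tρ : ρ.trace = ρ'.trace) (tσ : σ.trace = σ'.trace)
    (h : ∀ X, ∃ Y, ∀ t, quad ρ σ t Y = quad ρ' σ' t X) :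
    divSum (U'ᴴ * V') l' m' ≤ divSum (Uᴴ * V) l m := by
  have d1 : ∀ t : ℝ, 0 ≤ t → _ := fun t ht => hasDerivAt_divPrim (hρ.overlap hσ) hl hm ht
  have d2 : ∀ t : ℝ, 0 ≤ t → _ := fun t ht => hasDerivAt_divPrim (hρ'.overlap hσ') hl' hm' ht
  have s1 : ∑ i, l i = ∑ i, l' i := by
    have := hρ.trace_eq.symm.trans (tρ.trans hρ'.trace_eq); exact_mod_cast this
  have s2 : ∑ i, m i = ∑ i, m' i := by
    have := hσ.trace_eq.symm.trans (tσ.trans hσ'.trace_eq); exact_mod_cast this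
  -- With equal traces, the derivative of the difference is `t` times the difference of the two
  -- suprema, which `h` makes nonnegative. The difference starts at 0 and tends to the difference of
  -- relative entropies, so no integral has to be evaluated.
  have mono : MonotoneOn (fun t => divPrim (Uᴴ * V) l m t - divPrim (U'ᴴ * V') l' m' t)
      (Set.Ici 0) := by
    refine monotoneOn_of_hasDerivWithinAt_nonneg (convex_Ici 0)
      (fun t ht => ((d1 t ht).sub (d2 t ht)).continuousAt.continuousWithinAt)
      (fun t ht => ((d1 t ?_).sub (d2 t ?_)).hasDerivWithinAt) (fun t ht => ?_)
    · exact interior_subset ht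
    · exact interior_subset ht
    · have ht0 : 0 ≤ t := interior_subset ht
      obtain ⟨X, hX⟩ := exists_quad_eq_quadSup hρ' hσ' hl' hm' ht0
      obtain ⟨Y, hY⟩ := h X
      have : quadSup (U'ᴴ * V') l' m' t ≤ quadSup (Uᴴ * V) l m t := by
        rw [← hX, ← hY]
        exact quad_le_quadSup hρ hσ hl hm ht0 Y
      rw [s1, s2]
      nlinarith [mul_le_mul_of_nonneg_left this ht0]
  have lim := (tendsto_divPrim (Uᴴ * V) hl hm).sub (tendsto_divPrim (U'ᴴ * V') hl' hm')
  have : 0 ≤ divSum (Uᴴ * V) l m - divSum (U'ᴴ * V') l' m' := by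
    refine ge_of_tendsto lim ?_
    filter_upwards [eventually_ge_atTop 0] with t ht
    have := mono (Set.mem_Ici.2 le_rfl) ht ht
    simpa [divPrim_zero] using this
  linarith

theorem divSum_eq (hρ : IsSpectral ρ U l) (hσ : IsSpectral σ V m) :
    divSum (Uᴴ * V) l m =
      -(Real.log 2 * entropy ρ) - ∑ j, ((Vᴴ * ρ * V) j j).re * Real.log (m j) := by
  have hu : (Uᴴ * V) * (Uᴴ * V)ᴴ = 1 := by
    rw [conjTranspose_mul, conjTranspose_conjTranspose, Matrix.mul_assoc, ← Matrix.mul_assoc V,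
      hσ.unitary', Matrix.one_mul, hρ.unitary]
  have h1 : ∀ j, ((Vᴴ * ρ * V) j j).re = ∑ i, ‖(Uᴴ * V) i j‖ ^ 2 * l i := by
    intro j
    have : Vᴴ * ρ * V = (Uᴴ * V)ᴴ * (diagonal (fun i => (l i : ℂ)) * (Uᴴ * V)) := by
      rw [hρ.eq]
      simp only [conjTranspose_mul, conjTranspose_conjTranspose, Matrix.mul_assoc]
    rw [this, Matrix.mul_apply, Complex.re_sum]
    refine Finset.sum_congr rfl fun i _ => ?_
    rw [diagonal_mul, conjTranspose_apply]
    generalize (Uᴴ * V) i j = u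
    simp only [Complex.sq_norm, Complex.normSq_apply, Complex.star_def, Complex.mul_re,
      Complex.conj_re, Complex.conj_im, Complex.mul_im, Complex.ofReal_re, Complex.ofReal_im]
    ring
  have h2 : Real.log 2 * entropy ρ = -∑ i, l i * Real.log (l i) := by
    rw [hρ.entropy_eq, ← Finset.sum_div, mul_div_cancel₀ _ (Real.log_pos one_lt_two).ne']
    simp [Real.negMulLog]
  simp only [h1, h2, neg_neg, divSum, mul_sub, Finset.sum_sub_distrib]
  congr 1
  · refine Finset.sum_congr rfl fun i _ => ?_
    rw [← Finset.sum_mul, sum_norm_sq_row hu, one_mul]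
  · rw [Finset.sum_comm]
    refine Finset.sum_congr rfl fun i _ => ?_
    rw [Finset.sum_mul]
    exact Finset.sum_congr rfl fun j _ => by ring

end RelativeEntropy
end QInfo

namespace QInfo

open Matrix Filter Topology

/-! ### Marginals and their duality with tensoring by the identity. -/

section PartialTrace

variable {A C D : Type*}

theorem trace_traceRight [Fintype A] [Fintype C] (ρ : Matrix (A × C) (A × C) ℂ) :
    (traceRight ρ).trace = ρ.trace := by
  simp [traceRight, trace, Fintype.sum_prod_type]

theorem trace_traceLeft [Fintype A] [Fintype C] (ρ : Matrix (A × C) (A × C) ℂ) :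
    (traceLeft ρ).trace = ρ.trace := by
  simp only [traceLeft, trace, Fintype.sum_prod_type, diag_apply, of_apply]
  exact Finset.sum_comm

theorem trace_marginal12 [Fintype A] [Fintype C] [Fintype D]
    (ρ : Matrix (C × A × D) (C × A × D) ℂ) : (marginal12 ρ).trace = ρ.trace := by
  simp [marginal12, trace, Fintype.sum_prod_type]

theorem trace_marginal13 [Fintype A] [Fintype C] [Fintype D]
    (ρ : Matrix (C × A × D) (C × A × D) ℂ) : (marginal13 ρ).trace = ρ.trace := by
  simp only [marginal13, trace, Fintype.sum_prod_type, diag_apply, of_apply]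
  exact Finset.sum_congr rfl fun c _ => Finset.sum_comm

theorem traceRight_posSemidef [Fintype C] {ρ : Matrix (A × C) (A × C) ℂ} (h : ρ.PosSemidef) :
    (traceRight ρ).PosSemidef := by
  have : traceRight ρ = ∑ c, ρ.submatrix (fun a => (a, c)) (fun a => (a, c)) := by
    ext i j; simp [traceRight, Matrix.sum_apply]
  rw [this]
  exact posSemidef_sum _ fun c _ => h.submatrix _

theorem traceLeft_posSemidef [Fintype A] {ρ : Matrix (A × C) (A × C) ℂ} (h : ρ.PosSemidef) :
    (traceLeft ρ).PosSemidef := by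
  have : traceLeft ρ = ∑ a, ρ.submatrix (fun c => (a, c)) (fun c => (a, c)) := by
    ext i j; simp [traceLeft, Matrix.sum_apply]
  rw [this]
  exact posSemidef_sum _ fun c _ => h.submatrix _

theorem marginal12_posSemidef [Fintype D] {ρ : Matrix (C × A × D) (C × A × D) ℂ}
    (h : ρ.PosSemidef) : (marginal12 ρ).PosSemidef := by
  have : marginal12 ρ = ∑ d, ρ.submatrix (fun i => (i.1, i.2, d)) (fun i => (i.1, i.2, d)) := by
    ext i j; simp [marginal12, Matrix.sum_apply]
  rw [this]
  exact posSemidef_sum _ fun c _ => h.submatrix _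

theorem marginal13_posSemidef [Fintype A] {ρ : Matrix (C × A × D) (C × A × D) ℂ}
    (h : ρ.PosSemidef) : (marginal13 ρ).PosSemidef := by
  have : marginal13 ρ = ∑ a, ρ.submatrix (fun i => (i.1, a, i.2)) (fun i => (i.1, a, i.2)) := by
    ext i j; simp [marginal13, Matrix.sum_apply]
  rw [this]
  exact posSemidef_sum _ fun c _ => h.submatrix _

theorem trace_kronecker_one_mul [Fintype A] [Fintype C] [DecidableEq C]
    (K : Matrix A A ℂ) (ρ : Matrix (A × C) (A × C) ℂ) :
    ((K ⊗ₖ (1 : Matrix C C ℂ)) * ρ).trace = (K * traceRight ρ).trace := by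
  simp only [trace, diag_apply, Matrix.mul_apply, Fintype.sum_prod_type, kroneckerMap_apply,
    one_apply, traceRight, of_apply, Finset.mul_sum]
  refine Finset.sum_congr rfl fun a _ => ?_
  rw [Finset.sum_comm]
  refine Finset.sum_congr rfl fun a' _ => ?_
  simp [ite_mul]

/-- The adjoint of the partial trace, tensoring with 1, is a *-homomorphism; hence even the terms
quadratic in `X` are carried to each other exactly. -/
theorem quad_kronecker_one [Fintype A] [Fintype C] [DecidableEq C] [DecidableEq A]
    (ρ σ : Matrix (A × C) (A × C) ℂ) (t : ℝ) (X : Matrix A A ℂ) :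
    quad ρ σ t (X ⊗ₖ (1 : Matrix C C ℂ)) = quad (traceRight ρ) (traceRight σ) t X := by
  simp only [quad, conjTranspose_kronecker, conjTranspose_one, ← mul_kronecker_mul,
    Matrix.mul_one, trace_kronecker_one_mul]

theorem quad_submatrix {n m : Type*} [Fintype n] [DecidableEq n] [Fintype m] [DecidableEq m]
    (e : n ≃ m) (ρ σ : Matrix m m ℂ) (t : ℝ) (X : Matrix m m ℂ) :
    quad (ρ.submatrix e e) (σ.submatrix e e) t (X.submatrix e e) = quad ρ σ t X := by
  have tr : ∀ M : Matrix m m ℂ, (M.submatrix e e).trace = M.trace := fun M => by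
    simp only [trace, diag_apply, submatrix_apply]
    exact Equiv.sum_comp e fun i => M i i
  simp only [quad, conjTranspose_submatrix, submatrix_mul_equiv, tr]

end PartialTrace

/-! ### Strong subadditivity. -/

section StrongSubadditivity

variable {C A D : Type*} [Fintype C] [DecidableEq C] [Fintype A] [DecidableEq A]
  [Fintype D] [DecidableEq D]

/-- This is D(ρ_CD ‖ ρ_C ⊗ 1) = S(C) − S(CD), with log 2 converting bits to nats: the logarithm of
the second argument sees only the marginal on `C`. -/
theorem divSum_traceRight_kronecker_one {ρ U : Matrix (C × D) (C × D) ℂ} {l : C × D → ℝ}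
    {V : Matrix C C ℂ} {m : C → ℝ} (hρ : IsSpectral ρ U l)
    (hτ : IsSpectral (traceRight ρ) V m) :
    divSum (Uᴴ * (V ⊗ₖ (1 : Matrix D D ℂ))) l (fun i => m i.1 * 1) =
      Real.log 2 * (entropy (traceRight ρ) - entropy ρ) := by
  rw [divSum_eq hρ (hτ.kronecker isSpectral_one), hτ.entropy_eq, ← Finset.sum_div, mul_sub,
    mul_div_cancel₀ _ (Real.log_pos one_lt_two).ne', Fintype.sum_prod_type, sub_eq_add_neg,
    sub_eq_add_neg, add_comm]
  congr 1
  rw [← Finset.sum_neg_distrib]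
  refine Finset.sum_congr rfl fun c _ => ?_
  simp only [mul_one]
  rw [← Finset.sum_mul, Real.negMulLog, neg_mul]
  congr 2
  have h1 := congrFun (congrFun hτ.conj_eq c) c
  rw [diagonal_apply_eq] at h1
  have h2 : ∑ d, ((V ⊗ₖ (1 : Matrix D D ℂ))ᴴ * ρ * (V ⊗ₖ (1 : Matrix D D ℂ))) (c, d) (c, d) =
      (Vᴴ * traceRight ρ * V) c c := by
    simp only [Matrix.mul_apply, Fintype.sum_prod_type, kroneckerMap_apply, conjTranspose_apply,
      one_apply, traceRight, of_apply, Finset.mul_sum, Finset.sum_mul]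
    simp only [mul_ite, mul_one, mul_zero, apply_ite star, star_zero, ite_mul, zero_mul,
      Finset.sum_ite_eq', Finset.mem_univ, if_true, Finset.sum_ite_irrel,
      Finset.sum_const_zero]
    rw [Finset.sum_comm]
    refine Finset.sum_congr rfl fun a _ => ?_
    rw [Finset.sum_comm]
  rw [← Complex.re_sum, h2, h1, Complex.ofReal_re]

/-- Regroups a state on `C A D` so that `A` comes last. -/
def swapEquiv (C A D : Type*) : (C × A) × D ≃ (C × D) × A where
  toFun i := ((i.1.1, i.2), i.1.2)
  invFun i := ((i.1.1, i.2), i.1.2)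

/-- Tracing out `A` cannot increase D(ρ_CAD ‖ ρ_CA ⊗ 1_D), which gives S(C) − S(CD) ≤ S(CA) −
S(CAD). Positive eigenvalues keep every logarithm regular; `ssa` removes this restriction. -/
theorem ssa_of_spectral {ρ U : Matrix ((C × A) × D) ((C × A) × D) ℂ} {l : (C × A) × D → ℝ}
    {U' : Matrix (C × D) (C × D) ℂ} {l' : C × D → ℝ}
    {V : Matrix (C × A) (C × A) ℂ} {m : C × A → ℝ} {V' : Matrix C C ℂ} {m' : C → ℝ}
    (hρ : IsSpectral ρ U l) (hl : ∀ i, 0 < l i)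
    (hρ' : IsSpectral (traceRight (ρ.submatrix (swapEquiv C A D).symm (swapEquiv C A D).symm)) U' l')
    (hl' : ∀ i, 0 < l' i)
    (hσ : IsSpectral (traceRight ρ) V m) (hm : ∀ i, 0 < m i)
    (hσ' : IsSpectral (traceRight (traceRight ρ)) V' m') (hm' : ∀ i, 0 < m' i) :
    entropy (traceRight (traceRight ρ)) + entropy ρ ≤ entropy (traceRight ρ) +
      entropy (traceRight (ρ.submatrix (swapEquiv C A D).symm (swapEquiv C A D).symm)) := by
  set e := swapEquiv C A D
  have hC : traceRight (traceRight (ρ.submatrix e.symm e.symm)) = traceRight (traceRight ρ) := by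
    ext i j
    simp only [traceRight, of_apply, submatrix_apply]
    exact Finset.sum_comm
  have hσ2 : traceRight ((traceRight ρ ⊗ₖ (1 : Matrix D D ℂ)).submatrix e.symm e.symm) =
      traceRight (traceRight ρ) ⊗ₖ (1 : Matrix D D ℂ) := by
    ext i j
    simp only [traceRight, of_apply, submatrix_apply, kroneckerMap_apply, Finset.sum_mul]
    rfl
  have tr : ∀ M : Matrix ((C × A) × D) ((C × A) × D) ℂ,
      M.trace = (traceRight (M.submatrix e.symm e.symm)).trace := fun M => by
    rw [trace_traceRight]
    simp only [trace, diag_apply, submatrix_apply]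
    exact (Equiv.sum_comp e.symm fun i => M i i).symm
  have key := divSum_mono hρ (hσ.kronecker isSpectral_one) hl (fun i => by simpa using hm i.1)
    hρ' (hσ'.kronecker isSpectral_one) hl' (fun i => by simpa using hm' i.1) (tr _)
    ((tr _).trans (congrArg trace hσ2)) (fun X => ⟨(X ⊗ₖ (1 : Matrix A A ℂ)).submatrix e e, fun t => by
      rw [← hσ2, ← quad_kronecker_one, ← quad_submatrix e]
      simp⟩)
  rw [divSum_traceRight_kronecker_one hρ hσ, divSum_traceRight_kronecker_one hρ' (hC ▸ hσ'), hC,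
    mul_le_mul_iff_right₀ (Real.log_pos one_lt_two)] at key
  linarith

omit [Fintype C] in
theorem traceRight_add_smul_one (M : Matrix (C × A) (C × A) ℂ) (ε : ℝ) :
    traceRight (M + (ε : ℂ) • 1) = traceRight M + ((Fintype.card A * ε : ℝ) : ℂ) • 1 := by
  ext i j
  by_cases hij : i = j <;> simp [traceRight, Finset.sum_add_distrib, one_apply, hij]

omit [DecidableEq C] in
theorem tendsto_entropy_shift (d : C → ℝ) (c : ℝ) :
    Tendsto (fun ε : ℝ => ∑ i, Real.negMulLog (d i + c * ε) / Real.log 2) (𝓝[>] 0)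
      (𝓝 (∑ i, Real.negMulLog (d i) / Real.log 2)) := by
  have h : Continuous (fun ε : ℝ => ∑ i, Real.negMulLog (d i + c * ε) / Real.log 2) := by
    have := Real.continuous_negMulLog
    fun_prop
  have := h.tendsto 0
  simp only [mul_zero, add_zero] at this
  exact this.mono_left nhdsWithin_le_nhds

/-- Strong subadditivity of the von Neumann entropy. -/
theorem ssa [Nonempty A] [Nonempty D] {τ : Matrix ((C × A) × D) ((C × A) × D) ℂ}
    (h : τ.PosSemidef) :
    entropy (traceRight (traceRight τ)) + entropy τ ≤ entropy (traceRight τ) +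
      entropy (traceRight (τ.submatrix (swapEquiv C A D).symm (swapEquiv C A D).symm)) := by
  set e := swapEquiv C A D
  have p1 := traceRight_posSemidef h
  have p2 := traceRight_posSemidef p1
  have p3 : (traceRight (τ.submatrix e.symm e.symm)).PosSemidef :=
    traceRight_posSemidef (h.submatrix _)
  have s0 := isSpectral_of_isHermitian h.1
  have s1 := isSpectral_of_isHermitian p1.1
  have s2 := isSpectral_of_isHermitian p2.1
  have s3 := isSpectral_of_isHermitian p3.1
  have l0 := tendsto_entropy_shift h.1.eigenvalues 1
  have l1 := tendsto_entropy_shift p1.1.eigenvalues (Fintype.card D)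
  have l2 := tendsto_entropy_shift p2.1.eigenvalues (Fintype.card A * Fintype.card D)
  have l3 := tendsto_entropy_shift p3.1.eigenvalues (Fintype.card A)
  rw [s0.entropy_eq, s1.entropy_eq, s2.entropy_eq, s3.entropy_eq]
  -- Apply the full-rank case to `τ + ε • 1` and let `ε` decrease to 0. Each marginal is shifted by
  -- `ε` times the dimension traced out; the trace need not be 1.
  refine le_of_tendsto_of_tendsto (l2.add l0) (l1.add l3) ?_
  filter_upwards [self_mem_nhdsWithin] with ε hε
  have hε : 0 < ε := hε
  have cA : (0 : ℝ) < Fintype.card A := by exact_mod_cast Fintype.card_pos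
  have cD : (0 : ℝ) < Fintype.card D := by exact_mod_cast Fintype.card_pos
  have t0 := s0.add_smul_one ε
  have t1 := s1.add_smul_one (Fintype.card D * ε)
  have t2 := s2.add_smul_one (Fintype.card A * (Fintype.card D * ε))
  have t3 := s3.add_smul_one (Fintype.card A * ε)
  have e3 : traceRight ((τ + (ε : ℂ) • 1).submatrix e.symm e.symm) =
      traceRight (τ.submatrix e.symm e.symm) + ((Fintype.card A * ε : ℝ) : ℂ) • 1 := by
    rw [← traceRight_add_smul_one]
    simp [submatrix_add, submatrix_smul]
  rw [← traceRight_add_smul_one, ← traceRight_add_smul_one] at t2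
  rw [← traceRight_add_smul_one] at t1
  rw [← e3] at t3
  have key := ssa_of_spectral t0 (fun i => add_pos_of_nonneg_of_pos (h.eigenvalues_nonneg i) hε)
    t3 (fun i => add_pos_of_nonneg_of_pos (p3.eigenvalues_nonneg i) (by positivity))
    t1 (fun i => add_pos_of_nonneg_of_pos (p1.eigenvalues_nonneg i) (by positivity))
    t2 (fun i => add_pos_of_nonneg_of_pos (p2.eigenvalues_nonneg i) (by positivity))
  rw [t0.entropy_eq, t2.entropy_eq, t1.entropy_eq, t3.entropy_eq] at key
  simpa only [one_mul, mul_assoc] using key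

theorem condMutualInfo_nonneg [Nonempty A] [Nonempty D] {ρ : Matrix (C × A × D) (C × A × D) ℂ}
    (h : ρ.PosSemidef) : 0 ≤ condMutualInfo ρ := by
  set a := Equiv.prodAssoc C A D
  have key := ssa (h.submatrix a)
  have e0 : entropy (ρ.submatrix a a) = entropy ρ := entropy_reindex a (fun i j => rfl) h.1
  have e1 : traceRight (ρ.submatrix a a) = marginal12 ρ := rfl
  have e2 : traceRight (marginal12 ρ) = traceRight ρ := by
    ext i j
    simp [traceRight, marginal12, Fintype.sum_prod_type]
  have e3 : traceRight ((ρ.submatrix a a).submatrix (swapEquiv C A D).symm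
      (swapEquiv C A D).symm) = marginal13 ρ := rfl
  rw [e3, e1, e2, e0] at key
  rw [condMutualInfo]
  linarith

end StrongSubadditivity
end QInfo

namespace QInfo

open Matrix

/-! ### Channels: composition, tensor product, preparation and flagged mixture. -/

section Channels

variable {A B V W Y : Type*}

theorem IsCPTP.idTensor_posSemidef [Fintype A] [Fintype B] [Fintype W]
    {T : Matrix B B ℂ →ₗ[ℂ] Matrix W W ℂ} (hT : IsCPTP T) {ρ : Matrix (A × B) (A × B) ℂ}
    (h : ρ.PosSemidef) : (idTensor A T ρ).PosSemidef := by
  -- Complete positivity is only postulated for the ancillas `Fin k`, so an arbitrary finite ancilla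
  -- is relabelled.
  set e := Fintype.equivFin A
  have := (hT.completelyPositive _ _ (h.submatrix (Prod.map e.symm id))).submatrix (Prod.map e id)
  convert this using 1
  ext i j
  simp [idTensor]

theorem IsCPTP.comp [Fintype B] [Fintype V] [Fintype W] {S : Matrix V V ℂ →ₗ[ℂ] Matrix W W ℂ}
    {T : Matrix B B ℂ →ₗ[ℂ] Matrix V V ℂ} (hS : IsCPTP S) (hT : IsCPTP T) : IsCPTP (S ∘ₗ T) :=
  ⟨fun k ρ h => hS.completelyPositive k _ (hT.completelyPositive k ρ h),
    fun ρ => (hS.tracePreserving _).trans (hT.tracePreserving ρ)⟩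

/-- Relabelling of the basis as a linear map. -/
def reindexMap (e : W ≃ V) : Matrix V V ℂ →ₗ[ℂ] Matrix W W ℂ where
  toFun ρ := ρ.submatrix e e
  map_add' _ _ := rfl
  map_smul' _ _ := rfl

theorem reindexMap_apply (e : W ≃ V) (ρ : Matrix V V ℂ) (i j : W) :
    reindexMap e ρ i j = ρ (e i) (e j) := rfl

theorem isCPTP_reindexMap [Fintype V] [Fintype W] (e : W ≃ V) : IsCPTP (reindexMap e) where
  completelyPositive _ _ h := h.submatrix (Prod.map id e)
  tracePreserving ρ := by
    exact Equiv.sum_comp e fun i => ρ i i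

/-- The channel `β ↦ τ ⊗ β` preparing an additional state `τ`. -/
def prepareMap (τ : Matrix Y Y ℂ) : Matrix B B ℂ →ₗ[ℂ] Matrix (Y × B) (Y × B) ℂ where
  toFun β := τ ⊗ₖ β
  map_add' _ _ := by ext; simp [mul_add]
  map_smul' _ _ := by ext; simp [mul_left_comm]

theorem isCPTP_prepareMap [Fintype Y] [Fintype B] {τ : Matrix Y Y ℂ} (h : τ.PosSemidef)
    (t : τ.trace = 1) : IsCPTP (prepareMap (B := B) τ) where
  completelyPositive k ρ hρ :=
    (h.kronecker hρ).submatrix (fun i : Fin k × Y × B => (i.2.1, (i.1, i.2.2)))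
  tracePreserving ρ := by
    classical
    simp [prepareMap, trace_kronecker, t]

/-- `id_A ⊗ T` as a linear map. -/
def idTensorMap (A : Type*) (T : Matrix B B ℂ →ₗ[ℂ] Matrix W W ℂ) :
    Matrix (A × B) (A × B) ℂ →ₗ[ℂ] Matrix (A × W) (A × W) ℂ where
  toFun := idTensor A T
  map_add' ρ σ := by
    ext i j
    exact congrFun (congrFun (T.map_add (of fun b b' => ρ (i.1, b) (j.1, b'))
      (of fun b b' => σ (i.1, b) (j.1, b'))) i.2) j.2
  map_smul' c ρ := by
    ext i j
    exact congrFun (congrFun (T.map_smul c (of fun b b' => ρ (i.1, b) (j.1, b'))) i.2) j.2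

theorem IsCPTP.idTensorMap [Fintype A] [Fintype B] [Fintype W]
    {T : Matrix B B ℂ →ₗ[ℂ] Matrix W W ℂ} (hT : IsCPTP T) : IsCPTP (idTensorMap A T) where
  completelyPositive k ρ hρ :=
    (hT.idTensor_posSemidef (A := Fin k × A)
      (hρ.submatrix fun i : (Fin k × A) × B => (i.1.1, (i.1.2, i.2)))).submatrix
        (fun i : Fin k × A × W => ((i.1, i.2.1), i.2.2))
  tracePreserving ρ := by
    simp only [QInfo.idTensorMap, LinearMap.coe_mk, AddHom.coe_mk, trace, diag_apply,
      Fintype.sum_prod_type, idTensor, of_apply]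
    refine Finset.sum_congr rfl fun a _ => ?_
    exact hT.tracePreserving (of fun b b' => ρ (a, b) (a, b'))

/-- The tensor product of two maps. -/
def tensorMap {B₁ B₂ W₁ W₂ : Type*} (T₁ : Matrix B₁ B₁ ℂ →ₗ[ℂ] Matrix W₁ W₁ ℂ)
    (T₂ : Matrix B₂ B₂ ℂ →ₗ[ℂ] Matrix W₂ W₂ ℂ) :
    Matrix (B₁ × B₂) (B₁ × B₂) ℂ →ₗ[ℂ] Matrix (W₁ × W₂) (W₁ × W₂) ℂ :=
  reindexMap (Equiv.prodComm _ _) ∘ₗ QInfo.idTensorMap W₂ T₁ ∘ₗ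
    reindexMap (Equiv.prodComm _ _) ∘ₗ QInfo.idTensorMap B₁ T₂

theorem IsCPTP.tensorMap {B₁ B₂ W₁ W₂ : Type*} [Fintype B₁] [Fintype B₂] [Fintype W₁] [Fintype W₂]
    {T₁ : Matrix B₁ B₁ ℂ →ₗ[ℂ] Matrix W₁ W₁ ℂ} {T₂ : Matrix B₂ B₂ ℂ →ₗ[ℂ] Matrix W₂ W₂ ℂ}
    (h₁ : IsCPTP T₁) (h₂ : IsCPTP T₂) : IsCPTP (tensorMap T₁ T₂) :=
  (isCPTP_reindexMap _).comp (h₁.idTensorMap.comp ((isCPTP_reindexMap _).comp h₂.idTensorMap))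

theorem tensorMap_mul {B₁ B₂ W₁ W₂ : Type*} (T₁ : Matrix B₁ B₁ ℂ →ₗ[ℂ] Matrix W₁ W₁ ℂ)
    (T₂ : Matrix B₂ B₂ ℂ →ₗ[ℂ] Matrix W₂ W₂ ℂ) (β₁ : Matrix B₁ B₁ ℂ) (β₂ : Matrix B₂ B₂ ℂ)
    (i j : W₁ × W₂) : tensorMap T₁ T₂ (β₁ ⊗ₖ β₂) i j = T₁ β₁ i.1 j.1 * T₂ β₂ i.2 j.2 := by
  have h2 : ∀ b b' : B₁, T₂ (of fun c c' => β₁ b b' * β₂ c c') = β₁ b b' • T₂ β₂ := fun b b' =>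
    T₂.map_smul (β₁ b b') β₂
  have h1 : T₁ (of fun b b' => β₁ b b' * T₂ β₂ i.2 j.2) = T₂ β₂ i.2 j.2 • T₁ β₁ := by
    rw [← T₁.map_smul]
    congr 1
    ext
    simp [mul_comm]
  have e : tensorMap T₁ T₂ (β₁ ⊗ₖ β₂) i j = T₁ (of fun b b' =>
      T₂ (of fun c c' => β₁ b b' * β₂ c c') i.2 j.2) i.1 j.1 := rfl
  simp only [e, h2, Matrix.smul_apply, smul_eq_mul, h1]
  ring

/-- Mixture of two maps, with a flag in the output telling which one was applied. -/
def flagMap {V W : Type*} (a b : ℝ) (S : Matrix B B ℂ →ₗ[ℂ] Matrix V V ℂ)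
    (T : Matrix B B ℂ →ₗ[ℂ] Matrix W W ℂ) :
    Matrix B B ℂ →ₗ[ℂ] Matrix (V ⊕ W) (V ⊕ W) ℂ where
  toFun β := fromBlocks ((a : ℂ) • S β) 0 0 ((b : ℂ) • T β)
  map_add' _ _ := by simp [fromBlocks_add]
  map_smul' _ _ := by
    simp only [map_smul, RingHom.id_apply, fromBlocks_smul, smul_zero, smul_comm (_ : ℂ) (_ : ℂ)]

open scoped MatrixOrder Matrix.Norms.L2Operator in
theorem posSemidef_fromBlocks_zero {m n : Type*} [Fintype m] [Fintype n] {P : Matrix m m ℂ} {Q : Matrix n n ℂ}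
    (hP : P.PosSemidef) (hQ : Q.PosSemidef) : (fromBlocks P 0 0 Q).PosSemidef := by
  classical
  obtain ⟨M, rfl⟩ := CStarAlgebra.nonneg_iff_eq_star_mul_self.mp hP.nonneg
  obtain ⟨N, rfl⟩ := CStarAlgebra.nonneg_iff_eq_star_mul_self.mp hQ.nonneg
  have := posSemidef_conjTranspose_mul_self (fromBlocks M 0 0 N)
  simpa [fromBlocks_conjTranspose, fromBlocks_multiply, star_eq_conjTranspose] using this

theorem IsCPTP.flagMap {V W : Type*} [Fintype B] [Fintype V] [Fintype W] {a b : ℝ} (ha : 0 ≤ a)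
    (hb : 0 ≤ b) (hab : a + b = 1) {S : Matrix B B ℂ →ₗ[ℂ] Matrix V V ℂ}
    {T : Matrix B B ℂ →ₗ[ℂ] Matrix W W ℂ} (hS : IsCPTP S) (hT : IsCPTP T) :
    IsCPTP (flagMap a b S T) where
  completelyPositive k ρ hρ := by
    have h1 := (hS.completelyPositive k ρ hρ).smul (a := (a : ℂ)) (by exact_mod_cast ha)
    have h2 := (hT.completelyPositive k ρ hρ).smul (a := (b : ℂ)) (by exact_mod_cast hb)
    convert (posSemidef_fromBlocks_zero h1 h2).submatrix (Equiv.prodSumDistrib (Fin k) V W) using 1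
    ext ⟨i, i' | i'⟩ ⟨j, j' | j'⟩ <;> simp [QInfo.flagMap, idTensor, Equiv.prodSumDistrib]
  tracePreserving ρ := by
    have : (QInfo.flagMap a b S T ρ).trace = a * (S ρ).trace + b * (T ρ).trace := by
      simp [QInfo.flagMap, trace, Finset.mul_sum]
    rw [this, hS.tracePreserving, hT.tracePreserving]
    rw [← add_mul, ← Complex.ofReal_add, hab, Complex.ofReal_one, one_mul]

end Channels

/-! ### Channels acting on one system of a tripartite state. -/

section ApplyMiddle

variable {X B R W : Type*}

theorem IsCPTP.applyMiddle_posSemidef [Fintype X] [Fintype B] [Fintype R] [Fintype W]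
    {T : Matrix B B ℂ →ₗ[ℂ] Matrix W W ℂ} (hT : IsCPTP T) {ρ : Matrix (X × B × R) (X × B × R) ℂ}
    (h : ρ.PosSemidef) : (applyMiddle T ρ).PosSemidef :=
  (hT.idTensor_posSemidef (A := X × R) (h.submatrix fun i : (X × R) × B => (i.1.1, i.2, i.1.2))).submatrix
    (fun i : X × W × R => ((i.1, i.2.2), i.2.1))

/-- Trace preservation fixes the state on `X R`. Consequently only S(XW) and S(XWR) in the
conditional mutual information depend on the channel. -/
theorem IsCPTP.marginal13_applyMiddle [Fintype B] [Fintype W]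
    {T : Matrix B B ℂ →ₗ[ℂ] Matrix W W ℂ} (hT : IsCPTP T) (ρ : Matrix (X × B × R) (X × B × R) ℂ) :
    marginal13 (applyMiddle T ρ) = marginal13 ρ := by
  ext i j
  exact hT.tracePreserving (of fun b b' => ρ (i.1, b, i.2) (j.1, b', j.2))

theorem traceRight_marginal13 [Fintype B] [Fintype R] (ρ : Matrix (X × B × R) (X × B × R) ℂ) :
    traceRight (marginal13 ρ) = traceRight ρ := by
  ext i j
  simp only [traceRight, marginal13, of_apply, Fintype.sum_prod_type]
  exact Finset.sum_comm

theorem traceRight_marginal12 [Fintype B] [Fintype R] (ρ : Matrix (X × B × R) (X × B × R) ℂ) :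
    traceRight (marginal12 ρ) = traceRight ρ := by
  ext i j
  simp [traceRight, marginal12, Fintype.sum_prod_type]

theorem IsCPTP.traceRight_applyMiddle [Fintype B] [Fintype W] [Fintype R]
    {T : Matrix B B ℂ →ₗ[ℂ] Matrix W W ℂ} (hT : IsCPTP T) (ρ : Matrix (X × B × R) (X × B × R) ℂ) :
    traceRight (applyMiddle T ρ) = traceRight ρ := by
  rw [← traceRight_marginal13, hT.marginal13_applyMiddle, traceRight_marginal13]

theorem IsCPTP.trace_applyMiddle [Fintype X] [Fintype B] [Fintype W] [Fintype R]
    {T : Matrix B B ℂ →ₗ[ℂ] Matrix W W ℂ} (hT : IsCPTP T) (ρ : Matrix (X × B × R) (X × B × R) ℂ) :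
    (applyMiddle T ρ).trace = ρ.trace := by
  rw [← trace_marginal13, hT.marginal13_applyMiddle, trace_marginal13]

/-- For a classical-quantum state, the entropy of the quantum part is at most the total entropy. -/
theorem entropy_traceLeft_le [Fintype X] [DecidableEq X] [Fintype W] [DecidableEq W] [Nonempty X]
    {ρ : Matrix (X × W) (X × W) ℂ} (h : ρ.PosSemidef) (hc : ∀ i j, i.1 ≠ j.1 → ρ i j = 0) :
    entropy (traceLeft ρ) ≤ entropy ρ := by
  -- The isometry `E` copies the classical letter. In the resulting state on `W X X`, both `W X`
  -- marginals and the whole state have entropy S(XW), so strong subadditivity conditioned on `W`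
  -- reads 0 ≤ S(XW) − S(W).
  set E : Matrix (W × X × X) (X × W) ℂ := of fun i k => if i = (k.2, k.1, k.1) then 1 else 0 with hE
  have h1 : ∀ {Z : Type _} (M : Matrix (X × W) Z ℂ) (i : W × X × X) (k : Z), (E * M) i k =
      if i.2.1 = i.2.2 then M (i.2.1, i.1) k else 0 := by
    rintro Z M ⟨w, x, x'⟩ k
    simp only [hE, Matrix.mul_apply, of_apply, Fintype.sum_prod_type, Prod.mk.injEq, ite_mul,
      one_mul, zero_mul, ite_and, Finset.sum_ite_eq, Finset.mem_univ, if_true]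
    by_cases hx : x = x' <;> simp [hx, eq_comm]
  have hE1 : Eᴴ * E = 1 := by
    ext k l
    rw [Matrix.mul_apply, Finset.sum_eq_single (k.2, k.1, k.1)]
    · simp [hE, one_apply, Prod.ext_iff, and_comm]
    · intro b _ hb
      simp [hE, hb]
    · simp
  have hτ : ∀ i j, (E * ρ * Eᴴ) i j = if i.2.1 = i.2.2 ∧ j.2.1 = j.2.2 then
      ρ (i.2.1, i.1) (j.2.1, j.1) else 0 := by
    have h2 : ∀ i j, (ρ * Eᴴ) i j = star ((E * ρᴴ) j i) := fun i j => by
      rw [← conjTranspose_apply, conjTranspose_mul, conjTranspose_conjTranspose]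
    intro i j
    rw [Matrix.mul_assoc, h1, h2, h1, h.1.eq, ite_and]
    by_cases a : i.2.1 = i.2.2 <;> by_cases b : j.2.1 = j.2.2 <;> simp [a, b]
    exact h.1.apply _ _
  set τ := E * ρ * Eᴴ with hτdef
  have pτ : τ.PosSemidef := by
    have := h.mul_mul_conjTranspose_same E
    exact this
  have key := condMutualInfo_nonneg pτ
  have e0 : entropy τ = entropy ρ := by
    have : ρ * Eᴴ * E = ρ := by rw [Matrix.mul_assoc, hE1, Matrix.mul_one]
    have h2 := entropy_mul_comm E (ρ * Eᴴ) (by rw [← Matrix.mul_assoc]; exact pτ.1)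
      (by rw [this]; exact h.1)
    rwa [← Matrix.mul_assoc, this] at h2
  have e1 : entropy (marginal12 τ) = entropy ρ := by
    refine entropy_reindex (Equiv.prodComm _ _) (fun i j => ?_) h.1
    simp only [marginal12, of_apply, hτ]
    by_cases hij : i.2 = j.2
    · simp [hij, Prod.swap]
    · rw [hc (Equiv.prodComm W X i) (Equiv.prodComm W X j) hij]
      refine Finset.sum_eq_zero fun d _ => if_neg ?_
      rintro ⟨a, b⟩
      exact hij (a.trans b.symm)
  have e2 : entropy (marginal13 τ) = entropy ρ := by
    refine entropy_reindex (Equiv.prodComm _ _) (fun i j => ?_) h.1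
    simp only [marginal13, of_apply, hτ]
    by_cases hij : i.2 = j.2
    · simp [hij, Prod.swap]
    · rw [hc (Equiv.prodComm W X i) (Equiv.prodComm W X j) hij]
      refine Finset.sum_eq_zero fun d _ => if_neg ?_
      rintro ⟨a, b⟩
      exact hij (a.symm.trans b)
  have e3 : traceRight τ = traceLeft ρ := by
    ext i j
    simp [traceRight, traceLeft, hτ, Fintype.sum_prod_type]
  rw [condMutualInfo, e0, e1, e2, e3] at key
  linarith

end ApplyMiddle
end QInfo

namespace QInfo

open Matrix

/-! ### Invariance under relabelling of systems. -/

section Reindex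

variable {X W R X' W' R' : Type*} [Fintype X] [DecidableEq X] [Fintype W] [DecidableEq W]
  [Fintype R] [DecidableEq R] [Fintype X'] [DecidableEq X'] [Fintype W'] [DecidableEq W']
  [Fintype R'] [DecidableEq R']

theorem mutualInfo_reindex {ρ : Matrix (X × W) (X × W) ℂ} {ρ' : Matrix (X' × W') (X' × W') ℂ}
    (eX : X' ≃ X) (eW : W' ≃ W) (h : ∀ i j, ρ' i j = ρ (eX i.1, eW i.2) (eX j.1, eW j.2))
    (hρ : ρ.PosSemidef) : mutualInfo ρ' = mutualInfo ρ := by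
  rw [mutualInfo, mutualInfo, entropy_reindex (eX.prodCongr eW) h hρ.1,
    entropy_reindex eX _ (traceRight_posSemidef hρ).1,
    entropy_reindex eW _ (traceLeft_posSemidef hρ).1]
  · intro i j
    simp only [traceLeft, of_apply, h]
    exact Equiv.sum_comp eX fun a => ρ (a, eW i) (a, eW j)
  · intro i j
    simp only [traceRight, of_apply, h]
    exact Equiv.sum_comp eW fun a => ρ (eX i, a) (eX j, a)

omit [DecidableEq R] [DecidableEq R'] in
theorem mutualInfo_marginal12_reindex {σ : Matrix (X × W × R) (X × W × R) ℂ}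
    {σ' : Matrix (X' × W' × R') (X' × W' × R') ℂ} (eX : X' ≃ X) (eW : W' ≃ W) (eR : R' ≃ R)
    (h : ∀ i j, σ' i j = σ (eX i.1, eW i.2.1, eR i.2.2) (eX j.1, eW j.2.1, eR j.2.2))
    (hσ : σ.PosSemidef) : mutualInfo (marginal12 σ') = mutualInfo (marginal12 σ) := by
  refine mutualInfo_reindex eX eW (fun i j => ?_) (marginal12_posSemidef hσ)
  simp only [marginal12, of_apply, h]
  exact Equiv.sum_comp eR fun a => σ (eX i.1, eW i.2, a) (eX j.1, eW j.2, a)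

theorem condMutualInfo_reindex {σ : Matrix (X × W × R) (X × W × R) ℂ}
    {σ' : Matrix (X' × W' × R') (X' × W' × R') ℂ} (eX : X' ≃ X) (eW : W' ≃ W) (eR : R' ≃ R)
    (h : ∀ i j, σ' i j = σ (eX i.1, eW i.2.1, eR i.2.2) (eX j.1, eW j.2.1, eR j.2.2))
    (hσ : σ.PosSemidef) : condMutualInfo σ' = condMutualInfo σ := by
  rw [condMutualInfo, condMutualInfo, entropy_reindex (eX.prodCongr (eW.prodCongr eR)) h hσ.1,
    entropy_reindex (eX.prodCongr eW) _ (marginal12_posSemidef hσ).1,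
    entropy_reindex (eX.prodCongr eR) _ (marginal13_posSemidef hσ).1,
    entropy_reindex eX _ (traceRight_posSemidef hσ).1]
  · intro i j
    simp only [traceRight, of_apply, h]
    exact Equiv.sum_comp (eW.prodCongr eR) fun a => σ (eX i, a) (eX j, a)
  · intro i j
    simp only [marginal13, of_apply, h]
    exact Equiv.sum_comp eW fun a => σ (eX i.1, a, eR i.2) (eX j.1, a, eR j.2)
  · intro i j
    simp only [marginal12, of_apply, h]
    exact Equiv.sum_comp eR fun a => σ (eX i.1, eW i.2, a) (eX j.1, eW j.2, a)

end Reindex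

/-! ### Basic properties of `infoSup`. -/

namespace CQSource

section

variable {X B R : Type*} [Fintype X] [DecidableEq X] [Fintype B] [Fintype R]

theorem state_posSemidef (ω : CQSource X B R) : ω.state.PosSemidef := by
  refine posSemidef_sum _ fun x _ => ?_
  refine PosSemidef.smul ?_ (by exact_mod_cast ω.p_nonneg x)
  have h1 : (Matrix.single x x (1 : ℂ)).PosSemidef := by
    rw [← diagonal_single]
    refine PosSemidef.diagonal fun y => ?_
    by_cases h : y = x
    · subst h; simp
    · simp [h]
  exact h1.kronecker (posSemidef_vecMulVec_self_star _)

theorem state_trace (ω : CQSource X B R) : ω.state.trace = 1 := by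
  have : ω.state.trace = ((∑ x, ω.p x * ∑ i, ‖ω.ψ x i‖ ^ 2 : ℝ) : ℂ) := by
    simp only [trace, diag_apply, state_apply, if_true, Fintype.sum_prod_type (α₁ := X)]
    push_cast
    simp only [Finset.mul_sum]
    refine Finset.sum_congr rfl fun x _ => Finset.sum_congr rfl fun i _ => ?_
    rw [← Complex.mul_conj']
    rfl
  rw [this]
  simp [ω.ψ_norm, ω.p_sum]

omit [DecidableEq X] in
theorem nonempty_X (ω : CQSource X B R) : Nonempty X := by
  by_contra h
  rw [not_nonempty_iff] at h
  simpa using ω.p_sum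

omit [DecidableEq X] in
theorem nonempty_R (ω : CQSource X B R) : Nonempty R := by
  by_contra h
  rw [not_nonempty_iff] at h
  obtain ⟨x⟩ := ω.nonempty_X
  simpa using ω.ψ_norm x

theorem applyMiddle_eq_zero {W : Type*} (ω : CQSource X B R)
    (T : Matrix B B ℂ →ₗ[ℂ] Matrix W W ℂ) {i j : X × W × R} (h : i.1 ≠ j.1) :
    applyMiddle T ω.state i j = 0 := by
  have : (of fun b b' => ω.state (i.1, b, i.2.2) (j.1, b', j.2.2)) = (0 : Matrix B B ℂ) := by
    ext b b'
    simp [state_apply, h]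
  simp [applyMiddle, this]

variable {W : Type*} [Fintype W] [DecidableEq W] {T : Matrix B B ℂ →ₗ[ℂ] Matrix W W ℂ}

/-- The mutual information `I(X:W)` after applying a channel. -/
noncomputable def info (ω : CQSource X B R) (T : Matrix B B ℂ →ₗ[ℂ] Matrix W W ℂ) : ℝ :=
  mutualInfo (marginal12 (applyMiddle T ω.state))

omit [DecidableEq W] in
theorem applyMiddle_trace (ω : CQSource X B R) (hT : IsCPTP T) :
    (applyMiddle T ω.state).trace = 1 := by rw [hT.trace_applyMiddle, ω.state_trace]

omit [DecidableEq W] in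
theorem applyMiddle_posSemidef (ω : CQSource X B R) (hT : IsCPTP T) :
    (applyMiddle T ω.state).PosSemidef := hT.applyMiddle_posSemidef ω.state_posSemidef

theorem info_eq (ω : CQSource X B R) (hT : IsCPTP T) : ω.info T = entropy (traceRight ω.state) +
    entropy (traceLeft (marginal12 (applyMiddle T ω.state))) -
    entropy (marginal12 (applyMiddle T ω.state)) := by
  rw [info, mutualInfo, traceRight_marginal12, hT.traceRight_applyMiddle]

/-- A bound uniform over all output dimensions. It makes the set defining `infoSup` bounded above,
so that `sSup` is a genuine supremum and not the default value 0. -/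
theorem info_le (ω : CQSource X B R) (hT : IsCPTP T) :
    ω.info T ≤ entropy (traceRight ω.state) := by
  have := ω.nonempty_X
  have := entropy_traceLeft_le (marginal12_posSemidef (ω.applyMiddle_posSemidef hT)) (fun i j h =>
    Finset.sum_eq_zero fun r _ => ω.applyMiddle_eq_zero T h)
  rw [ω.info_eq hT]
  linarith

variable [DecidableEq R]

/-- The conditional mutual information `I(R:W|X)` after applying a channel. -/
noncomputable def disturbance (ω : CQSource X B R) (T : Matrix B B ℂ →ₗ[ℂ] Matrix W W ℂ) : ℝ :=
  condMutualInfo (applyMiddle T ω.state)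

theorem disturbance_eq (ω : CQSource X B R) (hT : IsCPTP T) : ω.disturbance T =
    entropy (marginal12 (applyMiddle T ω.state)) + entropy (marginal13 ω.state) -
      entropy (traceRight ω.state) - entropy (applyMiddle T ω.state) := by
  rw [disturbance, condMutualInfo, hT.marginal13_applyMiddle, hT.traceRight_applyMiddle]

theorem disturbance_nonneg (ω : CQSource X B R) (hT : IsCPTP T) : 0 ≤ ω.disturbance T := by
  have : Nonempty W := by
    by_contra h
    rw [not_nonempty_iff] at h
    simpa [trace] using ω.applyMiddle_trace hT
  have := ω.nonempty_R
  exact condMutualInfo_nonneg (ω.applyMiddle_posSemidef hT)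

theorem le_infoSup (ω : CQSource X B R) (hT : IsCPTP T) {δ : ℝ} (h : ω.disturbance T ≤ δ) :
    ω.info T ≤ ω.infoSup δ := by
  have e := (Fintype.equivFin W).symm
  refine le_csSup ⟨entropy (traceRight ω.state), ?_⟩
    ⟨Fintype.card W, reindexMap e ∘ₗ T, (isCPTP_reindexMap e).comp hT, ?_, ?_⟩
  · rintro v ⟨d, S, hS, -, rfl⟩
    exact ω.info_le hS
  · exact (condMutualInfo_reindex (Equiv.refl _) e (Equiv.refl _) (fun i j => rfl)
      (ω.applyMiddle_posSemidef hT)).trans_le h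
  · exact (mutualInfo_marginal12_reindex (Equiv.refl _) e (Equiv.refl _) (fun i j => rfl)
      (ω.applyMiddle_posSemidef hT)).symm

/-- The channel discarding its input. -/
def discardMap (B : Type*) [Fintype B] : Matrix B B ℂ →ₗ[ℂ] Matrix (Fin 1) (Fin 1) ℂ where
  toFun β := of fun _ _ => β.trace
  map_add' _ _ := by ext; simp
  map_smul' _ _ := by ext; simp

theorem isCPTP_discardMap : IsCPTP (discardMap B) where
  completelyPositive k _ h := (traceRight_posSemidef h).submatrix (fun i : Fin k × Fin 1 => i.1)
  tracePreserving ρ := by simp [discardMap, trace]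

omit [DecidableEq R] in
theorem info_discardMap (ω : CQSource X B R) : ω.info (discardMap B) = 0 := by
  have p := marginal12_posSemidef (ω.applyMiddle_posSemidef isCPTP_discardMap)
  rw [ω.info_eq isCPTP_discardMap, entropy_subsingleton (traceLeft_posSemidef p).1
    (by rw [trace_traceLeft, trace_marginal12, ω.applyMiddle_trace isCPTP_discardMap])]
  have : entropy (marginal12 (applyMiddle (discardMap B) ω.state)) = entropy (traceRight ω.state) := by
    refine entropy_reindex (Equiv.prodUnique X (Fin 1)) (fun i j => ?_)
      (traceRight_posSemidef ω.state_posSemidef).1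
    simp only [marginal12, applyMiddle, traceRight, discardMap, of_apply, Fintype.sum_prod_type,
      LinearMap.coe_mk, AddHom.coe_mk, trace, diag_apply]
    exact Finset.sum_comm
  rw [this]
  ring

/-- Discarding the input is admissible for every `δ ≥ 0`, so the set defining `infoSup` is nonempty
there. -/
theorem disturbance_discardMap (ω : CQSource X B R) : ω.disturbance (discardMap B) = 0 := by
  -- As S(W) = 0 for a one-dimensional output, vanishing information forces S(XW) = S(X).
  have h := ω.info_discardMap
  have p := marginal12_posSemidef (ω.applyMiddle_posSemidef isCPTP_discardMap)
  rw [ω.info_eq isCPTP_discardMap, entropy_subsingleton (traceLeft_posSemidef p).1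
    (by rw [trace_traceLeft, trace_marginal12, ω.applyMiddle_trace isCPTP_discardMap])] at h
  have : entropy (applyMiddle (discardMap B) ω.state) = entropy (marginal13 ω.state) :=
    entropy_reindex ((Equiv.refl X).prodCongr (Equiv.uniqueProd R (Fin 1))) (fun i j => rfl)
      (marginal13_posSemidef ω.state_posSemidef).1
  rw [ω.disturbance_eq isCPTP_discardMap, this]
  linarith

theorem infoSup_le (ω : CQSource X B R) {δ c : ℝ} (hδ : 0 ≤ δ)
    (h : ∀ (d : ℕ) (T : Matrix B B ℂ →ₗ[ℂ] Matrix (Fin d) (Fin d) ℂ), IsCPTP T →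
      ω.disturbance T ≤ δ → ω.info T ≤ c) : ω.infoSup δ ≤ c := by
  refine csSup_le ⟨_, 1, discardMap B, isCPTP_discardMap, ω.disturbance_discardMap.trans_le hδ, rfl⟩ ?_
  rintro v ⟨d, T, hT, h1, rfl⟩
  exact h d T hT h1

theorem infoSup_nonneg (ω : CQSource X B R) {δ : ℝ} (hδ : 0 ≤ δ) : 0 ≤ ω.infoSup δ :=
  ω.info_discardMap.symm.trans_le
    (ω.le_infoSup isCPTP_discardMap (ω.disturbance_discardMap.trans_le hδ))

theorem infoSup_mono (ω : CQSource X B R) {δ δ' : ℝ} (hδ : 0 ≤ δ) (h : δ ≤ δ') :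
    ω.infoSup δ ≤ ω.infoSup δ' :=
  ω.infoSup_le hδ fun _ _ hT hd => ω.le_infoSup hT (hd.trans h)

theorem exists_lt_info (ω : CQSource X B R) {δ c : ℝ} (hδ : 0 ≤ δ) (h : c < ω.infoSup δ) :
    ∃ (d : ℕ) (T : Matrix B B ℂ →ₗ[ℂ] Matrix (Fin d) (Fin d) ℂ), IsCPTP T ∧
      ω.disturbance T ≤ δ ∧ c < ω.info T := by
  by_contra! hc
  exact absurd (ω.infoSup_le hδ hc) (not_le.mpr h)

end

theorem infoSup_reindex_le {X B R X' B' R' : Type*} [Fintype X] [DecidableEq X] [Fintype B]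
    [Fintype R] [DecidableEq R] [Fintype X'] [DecidableEq X'] [Fintype B'] [Fintype R']
    [DecidableEq R'] {ω : CQSource X B R} {ω' : CQSource X' B' R'} (eX : X' ≃ X) (eB : B' ≃ B)
    (eR : R' ≃ R) (h : ∀ i j, ω'.state i j =
      ω.state (eX i.1, eB i.2.1, eR i.2.2) (eX j.1, eB j.2.1, eR j.2.2)) {δ : ℝ} (hδ : 0 ≤ δ) :
    ω.infoSup δ ≤ ω'.infoSup δ := by
  refine ω.infoSup_le hδ fun d T hT hd => ?_
  have hT' := hT.comp (isCPTP_reindexMap eB.symm)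
  have key : ∀ i j, applyMiddle (T ∘ₗ reindexMap eB.symm) ω'.state i j = applyMiddle T ω.state
      (eX i.1, Equiv.refl _ i.2.1, eR i.2.2) (eX j.1, Equiv.refl _ j.2.1, eR j.2.2) := by
    intro i j
    simp only [applyMiddle, of_apply, LinearMap.comp_apply, Equiv.refl_apply]
    refine congrFun (congrFun (congrArg T ?_) _) _
    ext b b'
    simp [reindexMap_apply, h]
  have p := ω.applyMiddle_posSemidef hT
  have := ω'.le_infoSup hT' (δ := δ)
    ((condMutualInfo_reindex eX (Equiv.refl _) eR key p).trans_le hd)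
  rwa [info, mutualInfo_marginal12_reindex eX (Equiv.refl _) eR key p] at this

theorem infoSup_reindex {X B R X' B' R' : Type*} [Fintype X] [DecidableEq X] [Fintype B]
    [Fintype R] [DecidableEq R] [Fintype X'] [DecidableEq X'] [Fintype B'] [Fintype R']
    [DecidableEq R'] {ω : CQSource X B R} {ω' : CQSource X' B' R'} (eX : X' ≃ X) (eB : B' ≃ B)
    (eR : R' ≃ R) (h : ∀ i j, ω'.state i j =
      ω.state (eX i.1, eB i.2.1, eR i.2.2) (eX j.1, eB j.2.1, eR j.2.2)) {δ : ℝ} (hδ : 0 ≤ δ) :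
    ω'.infoSup δ = ω.infoSup δ :=
  le_antisymm (infoSup_reindex_le eX.symm eB.symm eR.symm (by simp [h]) hδ)
    (infoSup_reindex_le eX eB eR h hδ)

end CQSource
end QInfo

namespace QInfo

open Matrix

namespace CQSource

/-! ### Concavity of `infoSup` by flagged mixtures of channels. -/

section Concavity

variable {X B R : Type*} [Fintype X] [DecidableEq X] [Fintype B] [Fintype R]
variable {V W : Type*} [Fintype V] [DecidableEq V] [Fintype W] [DecidableEq W]
  {S : Matrix B B ℂ →ₗ[ℂ] Matrix V V ℂ} {T : Matrix B B ℂ →ₗ[ℂ] Matrix W W ℂ} {a b : ℝ}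

theorem entropy_marginal12_flagMap (ω : CQSource X B R) (hS : IsCPTP S) (hT : IsCPTP T) :
    entropy (marginal12 (applyMiddle (flagMap a b S T) ω.state)) =
      a * entropy (marginal12 (applyMiddle S ω.state)) +
      b * entropy (marginal12 (applyMiddle T ω.state)) +
      (Real.negMulLog a / Real.log 2 + Real.negMulLog b / Real.log 2) := by
  refine entropy_of_sum (Equiv.prodSumDistrib X V W) a b ?_
    (marginal12_posSemidef (ω.applyMiddle_posSemidef hS)).1
    (marginal12_posSemidef (ω.applyMiddle_posSemidef hT)).1
    (by rw [trace_marginal12, ω.applyMiddle_trace hS])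
    (by rw [trace_marginal12, ω.applyMiddle_trace hT])
  rintro ⟨x, v | w⟩ ⟨y, v' | w'⟩ <;>
    simp [Equiv.prodSumDistrib, marginal12, applyMiddle, flagMap, Finset.mul_sum]

theorem entropy_traceLeft_flagMap (ω : CQSource X B R) (hS : IsCPTP S) (hT : IsCPTP T) :
    entropy (traceLeft (marginal12 (applyMiddle (flagMap a b S T) ω.state))) =
      a * entropy (traceLeft (marginal12 (applyMiddle S ω.state))) +
      b * entropy (traceLeft (marginal12 (applyMiddle T ω.state))) +
      (Real.negMulLog a / Real.log 2 + Real.negMulLog b / Real.log 2) := by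
  refine entropy_of_sum (Equiv.refl (V ⊕ W)) a b ?_
    (traceLeft_posSemidef (marginal12_posSemidef (ω.applyMiddle_posSemidef hS))).1
    (traceLeft_posSemidef (marginal12_posSemidef (ω.applyMiddle_posSemidef hT))).1
    (by rw [trace_traceLeft, trace_marginal12, ω.applyMiddle_trace hS])
    (by rw [trace_traceLeft, trace_marginal12, ω.applyMiddle_trace hT])
  rintro (v | w) (v' | w') <;>
    simp [traceLeft, marginal12, applyMiddle, flagMap, Finset.mul_sum]

/-- The flag makes the output block diagonal, so S(W) and S(XW) become averages plus the same flag
entropy, which cancels. The same cancellation between S(XW) and S(XWR) makes `disturbance` affine.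
-/
theorem info_flagMap (ω : CQSource X B R) (ha : 0 ≤ a) (hb : 0 ≤ b) (hab : a + b = 1)
    (hS : IsCPTP S) (hT : IsCPTP T) :
    ω.info (flagMap a b S T) = a * ω.info S + b * ω.info T := by
  rw [ω.info_eq hS, ω.info_eq hT, ω.info_eq (hS.flagMap ha hb hab hT),
    ω.entropy_marginal12_flagMap hS hT, ω.entropy_traceLeft_flagMap hS hT]
  obtain rfl : b = 1 - a := by linarith
  ring

variable [DecidableEq R]

theorem entropy_applyMiddle_flagMap (ω : CQSource X B R) (hS : IsCPTP S) (hT : IsCPTP T) :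
    entropy (applyMiddle (flagMap a b S T) ω.state) =
      a * entropy (applyMiddle S ω.state) + b * entropy (applyMiddle T ω.state) +
      (Real.negMulLog a / Real.log 2 + Real.negMulLog b / Real.log 2) := by
  refine entropy_of_sum (((Equiv.refl X).prodCongr (Equiv.sumProdDistrib V W R)).trans
    (Equiv.prodSumDistrib X (V × R) (W × R))) a b ?_
    (ω.applyMiddle_posSemidef hS).1 (ω.applyMiddle_posSemidef hT).1
    (ω.applyMiddle_trace hS) (ω.applyMiddle_trace hT)
  rintro ⟨x, v | w, r⟩ ⟨y, v' | w', r'⟩ <;>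
    simp [Equiv.prodSumDistrib, applyMiddle, flagMap]

theorem disturbance_flagMap (ω : CQSource X B R) (ha : 0 ≤ a) (hb : 0 ≤ b) (hab : a + b = 1)
    (hS : IsCPTP S) (hT : IsCPTP T) :
    ω.disturbance (flagMap a b S T) = a * ω.disturbance S + b * ω.disturbance T := by
  rw [ω.disturbance_eq hS, ω.disturbance_eq hT, ω.disturbance_eq (hS.flagMap ha hb hab hT),
    ω.entropy_marginal12_flagMap hS hT, ω.entropy_applyMiddle_flagMap hS hT]
  obtain rfl : b = 1 - a := by linarith
  ring

theorem concaveOn_infoSup (ω : CQSource X B R) : ConcaveOn ℝ (Set.Ici 0) ω.infoSup := by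
  refine ⟨convex_Ici 0, fun δ₁ h₁ δ₂ h₂ a b ha hb hab => ?_⟩
  rw [Set.mem_Ici] at h₁ h₂
  simp only [smul_eq_mul]
  refine le_of_forall_pos_le_add fun ε hε => ?_
  obtain ⟨d, S, hS, hSd, hSi⟩ := ω.exists_lt_info h₁ (sub_lt_self _ hε)
  obtain ⟨e, T, hT, hTd, hTi⟩ := ω.exists_lt_info h₂ (sub_lt_self _ hε)
  have := ω.le_infoSup (hS.flagMap ha hb hab hT) (δ := a * δ₁ + b * δ₂) (by
    rw [ω.disturbance_flagMap ha hb hab hS hT]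
    exact add_le_add (mul_le_mul_of_nonneg_left hSd ha) (mul_le_mul_of_nonneg_left hTd hb))
  rw [ω.info_flagMap ha hb hab hS hT] at this
  have e1 := mul_le_mul_of_nonneg_left hSi.le ha
  have e2 := mul_le_mul_of_nonneg_left hTi.le hb
  obtain rfl : b = 1 - a := by linarith
  linarith

end Concavity

/-! ### The product formula. -/

section Product

variable {X₁ B₁ R₁ X₂ B₂ R₂ : Type*}
    [Fintype X₁] [DecidableEq X₁] [Fintype B₁] [Fintype R₁] [DecidableEq R₁]
    [Fintype X₂] [DecidableEq X₂] [Fintype B₂] [Fintype R₂] [DecidableEq R₂]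

omit [DecidableEq R₁] [DecidableEq R₂] in
theorem entropy_traceRight_prod (ω₁ : CQSource X₁ B₁ R₁) (ω₂ : CQSource X₂ B₂ R₂) :
    entropy (traceRight (ω₁.prod ω₂).state) =
      entropy (traceRight ω₁.state) + entropy (traceRight ω₂.state) := by
  refine entropy_of_mul (Equiv.refl _) (fun i j => ?_) (traceRight_posSemidef ω₁.state_posSemidef).1
    (traceRight_posSemidef ω₂.state_posSemidef).1 (by rw [trace_traceRight, state_trace])
    (by rw [trace_traceRight, state_trace])
  simp only [traceRight, of_apply, prod_state_apply, Equiv.refl_apply, Finset.sum_mul_sum,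
    ← Fintype.sum_prod_type']
  exact Equiv.sum_comp (Equiv.prodProdProdComm B₁ B₂ R₁ R₂) fun c =>
    ω₁.state (i.1, c.1) (j.1, c.1) * ω₂.state (i.2, c.2) (j.2, c.2)

theorem entropy_marginal13_prod (ω₁ : CQSource X₁ B₁ R₁) (ω₂ : CQSource X₂ B₂ R₂) :
    entropy (marginal13 (ω₁.prod ω₂).state) =
      entropy (marginal13 ω₁.state) + entropy (marginal13 ω₂.state) := by
  refine entropy_of_mul (Equiv.prodProdProdComm X₁ X₂ R₁ R₂) (fun i j => ?_)
    (marginal13_posSemidef ω₁.state_posSemidef).1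
    (marginal13_posSemidef ω₂.state_posSemidef).1 (by rw [trace_marginal13, state_trace])
    (by rw [trace_marginal13, state_trace])
  simp only [marginal13, of_apply, prod_state_apply, Finset.sum_mul_sum, ← Fintype.sum_prod_type']
  rfl

section Tensor

variable {W₁ W₂ : Type*} [Fintype W₁] [DecidableEq W₁] [Fintype W₂] [DecidableEq W₂]
  {T₁ : Matrix B₁ B₁ ℂ →ₗ[ℂ] Matrix W₁ W₁ ℂ} {T₂ : Matrix B₂ B₂ ℂ →ₗ[ℂ] Matrix W₂ W₂ ℂ}

omit [DecidableEq R₁] [DecidableEq R₂] [Fintype W₁] [DecidableEq W₁] [Fintype W₂]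
  [DecidableEq W₂] in
theorem applyMiddle_tensorMap (ω₁ : CQSource X₁ B₁ R₁) (ω₂ : CQSource X₂ B₂ R₂)
    (T₁ : Matrix B₁ B₁ ℂ →ₗ[ℂ] Matrix W₁ W₁ ℂ) (T₂ : Matrix B₂ B₂ ℂ →ₗ[ℂ] Matrix W₂ W₂ ℂ)
    (i j : (X₁ × X₂) × (W₁ × W₂) × (R₁ × R₂)) :
    applyMiddle (tensorMap T₁ T₂) (ω₁.prod ω₂).state i j =
      applyMiddle T₁ ω₁.state (i.1.1, i.2.1.1, i.2.2.1) (j.1.1, j.2.1.1, j.2.2.1) *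
      applyMiddle T₂ ω₂.state (i.1.2, i.2.1.2, i.2.2.2) (j.1.2, j.2.1.2, j.2.2.2) := by
  simp only [applyMiddle, of_apply, prod_state_apply]
  exact tensorMap_mul T₁ T₂ (of fun b b' => ω₁.state (i.1.1, b, i.2.2.1) (j.1.1, b', j.2.2.1))
    (of fun b b' => ω₂.state (i.1.2, b, i.2.2.2) (j.1.2, b', j.2.2.2)) i.2.1 j.2.1

omit [DecidableEq R₁] [DecidableEq R₂] [Fintype W₁] [DecidableEq W₁] [Fintype W₂]
  [DecidableEq W₂] in
theorem marginal12_tensorMap (ω₁ : CQSource X₁ B₁ R₁) (ω₂ : CQSource X₂ B₂ R₂)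
    (T₁ : Matrix B₁ B₁ ℂ →ₗ[ℂ] Matrix W₁ W₁ ℂ) (T₂ : Matrix B₂ B₂ ℂ →ₗ[ℂ] Matrix W₂ W₂ ℂ)
    (i j : (X₁ × X₂) × (W₁ × W₂)) :
    marginal12 (applyMiddle (tensorMap T₁ T₂) (ω₁.prod ω₂).state) i j =
      marginal12 (applyMiddle T₁ ω₁.state) (i.1.1, i.2.1) (j.1.1, j.2.1) *
      marginal12 (applyMiddle T₂ ω₂.state) (i.1.2, i.2.2) (j.1.2, j.2.2) := by
  simp only [marginal12, of_apply, applyMiddle_tensorMap, Finset.sum_mul_sum,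
    ← Fintype.sum_prod_type']

omit [DecidableEq R₁] [DecidableEq R₂] in
theorem entropy_marginal12_tensorMap (ω₁ : CQSource X₁ B₁ R₁) (ω₂ : CQSource X₂ B₂ R₂)
    (h₁ : IsCPTP T₁) (h₂ : IsCPTP T₂) :
    entropy (marginal12 (applyMiddle (tensorMap T₁ T₂) (ω₁.prod ω₂).state)) =
      entropy (marginal12 (applyMiddle T₁ ω₁.state)) +
      entropy (marginal12 (applyMiddle T₂ ω₂.state)) :=
  entropy_of_mul (Equiv.prodProdProdComm X₁ X₂ W₁ W₂)
    (fun i j => marginal12_tensorMap ω₁ ω₂ T₁ T₂ i j)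
    (marginal12_posSemidef (ω₁.applyMiddle_posSemidef h₁)).1
    (marginal12_posSemidef (ω₂.applyMiddle_posSemidef h₂)).1
    (by rw [trace_marginal12, ω₁.applyMiddle_trace h₁])
    (by rw [trace_marginal12, ω₂.applyMiddle_trace h₂])

omit [DecidableEq R₁] [DecidableEq R₂] in
theorem info_tensorMap (ω₁ : CQSource X₁ B₁ R₁) (ω₂ : CQSource X₂ B₂ R₂)
    (h₁ : IsCPTP T₁) (h₂ : IsCPTP T₂) :
    (ω₁.prod ω₂).info (tensorMap T₁ T₂) = ω₁.info T₁ + ω₂.info T₂ := by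
  have : entropy (traceLeft (marginal12 (applyMiddle (tensorMap T₁ T₂) (ω₁.prod ω₂).state))) =
      entropy (traceLeft (marginal12 (applyMiddle T₁ ω₁.state))) +
      entropy (traceLeft (marginal12 (applyMiddle T₂ ω₂.state))) := by
    refine entropy_of_mul (Equiv.refl _) (fun i j => ?_)
      (traceLeft_posSemidef (marginal12_posSemidef (ω₁.applyMiddle_posSemidef h₁))).1
      (traceLeft_posSemidef (marginal12_posSemidef (ω₂.applyMiddle_posSemidef h₂))).1
      (by rw [trace_traceLeft, trace_marginal12, ω₁.applyMiddle_trace h₁])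
      (by rw [trace_traceLeft, trace_marginal12, ω₂.applyMiddle_trace h₂])
    simp only [traceLeft, of_apply, marginal12_tensorMap, Finset.sum_mul_sum, Equiv.refl_apply,
      ← Fintype.sum_prod_type']
  rw [ω₁.info_eq h₁, ω₂.info_eq h₂, (ω₁.prod ω₂).info_eq (h₁.tensorMap h₂), this,
    entropy_marginal12_tensorMap ω₁ ω₂ h₁ h₂, entropy_traceRight_prod]
  ring

theorem disturbance_tensorMap (ω₁ : CQSource X₁ B₁ R₁) (ω₂ : CQSource X₂ B₂ R₂)
    (h₁ : IsCPTP T₁) (h₂ : IsCPTP T₂) :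
    (ω₁.prod ω₂).disturbance (tensorMap T₁ T₂) = ω₁.disturbance T₁ + ω₂.disturbance T₂ := by
  have : entropy (applyMiddle (tensorMap T₁ T₂) (ω₁.prod ω₂).state) =
      entropy (applyMiddle T₁ ω₁.state) + entropy (applyMiddle T₂ ω₂.state) :=
    entropy_of_mul (((Equiv.refl _).prodCongr (Equiv.prodProdProdComm W₁ W₂ R₁ R₂)).trans
      (Equiv.prodProdProdComm X₁ X₂ (W₁ × R₁) (W₂ × R₂)))
      (fun i j => applyMiddle_tensorMap ω₁ ω₂ T₁ T₂ i j)
      (ω₁.applyMiddle_posSemidef h₁).1 (ω₂.applyMiddle_posSemidef h₂).1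
      (ω₁.applyMiddle_trace h₁) (ω₂.applyMiddle_trace h₂)
  rw [ω₁.disturbance_eq h₁, ω₂.disturbance_eq h₂, (ω₁.prod ω₂).disturbance_eq (h₁.tensorMap h₂),
    this, entropy_marginal12_tensorMap ω₁ ω₂ h₁ h₂, entropy_traceRight_prod,
    entropy_marginal13_prod]
  ring

end Tensor

theorem infoSup_add_le_infoSup_prod (ω₁ : CQSource X₁ B₁ R₁) (ω₂ : CQSource X₂ B₂ R₂)
    {δ₁ δ₂ : ℝ} (hδ₁ : 0 ≤ δ₁) (hδ₂ : 0 ≤ δ₂) :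
    ω₁.infoSup δ₁ + ω₂.infoSup δ₂ ≤ (ω₁.prod ω₂).infoSup (δ₁ + δ₂) := by
  refine le_of_forall_pos_le_add fun ε hε => ?_
  obtain ⟨d, S, hS, hSd, hSi⟩ := ω₁.exists_lt_info hδ₁ (sub_lt_self _ (half_pos hε))
  obtain ⟨e, T, hT, hTd, hTi⟩ := ω₂.exists_lt_info hδ₂ (sub_lt_self _ (half_pos hε))
  have := (ω₁.prod ω₂).le_infoSup (hS.tensorMap hT) (δ := δ₁ + δ₂) (by
    rw [disturbance_tensorMap ω₁ ω₂ hS hT]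
    exact add_le_add hSd hTd)
  rw [info_tensorMap ω₁ ω₂ hS hT] at this
  linarith

/-- The channel induced on the first factor when the second source provides the other input. -/
noncomputable def leftMap {W : Type*} (ω₂ : CQSource X₂ B₂ R₂)
    (T : Matrix (B₁ × B₂) (B₁ × B₂) ℂ →ₗ[ℂ] Matrix W W ℂ) : Matrix B₁ B₁ ℂ →ₗ[ℂ] Matrix W W ℂ :=
  T ∘ₗ reindexMap (Equiv.prodComm B₁ B₂) ∘ₗ prepareMap (traceRight (traceLeft ω₂.state))

/-- The channel induced on the second factor when the first source provides the other input, and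
its systems `X₁` and `R₁` are kept in the output. -/
noncomputable def rightMap {W : Type*} (ω₁ : CQSource X₁ B₁ R₁)
    (T : Matrix (B₁ × B₂) (B₁ × B₂) ℂ →ₗ[ℂ] Matrix W W ℂ) :
    Matrix B₂ B₂ ℂ →ₗ[ℂ] Matrix ((X₁ × R₁) × W) ((X₁ × R₁) × W) ℂ :=
  idTensorMap (X₁ × R₁) T ∘ₗ reindexMap (Equiv.prodAssoc (X₁ × R₁) B₁ B₂).symm ∘ₗ
    prepareMap (ω₁.state.submatrix (fun i : (X₁ × R₁) × B₁ => (i.1.1, i.2, i.1.2))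
      (fun i : (X₁ × R₁) × B₁ => (i.1.1, i.2, i.1.2)))

variable {W : Type*} [Fintype W] [DecidableEq W]
  {T : Matrix (B₁ × B₂) (B₁ × B₂) ℂ →ₗ[ℂ] Matrix W W ℂ}

omit [DecidableEq R₂] [DecidableEq W] in
theorem _root_.QInfo.IsCPTP.leftMap (hT : IsCPTP T) (ω₂ : CQSource X₂ B₂ R₂) :
    IsCPTP (leftMap ω₂ T) :=
  hT.comp ((isCPTP_reindexMap _).comp (isCPTP_prepareMap
    (traceRight_posSemidef (traceLeft_posSemidef ω₂.state_posSemidef))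
    (by rw [trace_traceRight, trace_traceLeft, state_trace])))

omit [DecidableEq R₁] [DecidableEq W] in
theorem _root_.QInfo.IsCPTP.rightMap (hT : IsCPTP T) (ω₁ : CQSource X₁ B₁ R₁) :
    IsCPTP (rightMap ω₁ T) := by
  refine hT.idTensorMap.comp ((isCPTP_reindexMap _).comp (isCPTP_prepareMap
    (ω₁.state_posSemidef.submatrix _) ?_))
  rw [← ω₁.state_trace]
  exact Equiv.sum_comp (⟨fun i : (X₁ × R₁) × B₁ => (i.1.1, i.2, i.1.2),
    fun i => ((i.1, i.2.2), i.2.1), fun _ => rfl, fun _ => rfl⟩ : (X₁ × R₁) × B₁ ≃ X₁ × B₁ × R₁)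
    fun i => ω₁.state i i

omit [DecidableEq R₁] [DecidableEq R₂] [Fintype W] [DecidableEq W] in
theorem applyMiddle_leftMap (ω₁ : CQSource X₁ B₁ R₁) (ω₂ : CQSource X₂ B₂ R₂)
    (i j : X₁ × W × R₁) : applyMiddle (leftMap ω₂ T) ω₁.state i j =
      ∑ x, ∑ r, applyMiddle T (ω₁.prod ω₂).state ((i.1, x), i.2.1, (i.2.2, r))
        ((j.1, x), j.2.1, (j.2.2, r)) := by
  simp only [applyMiddle, of_apply, leftMap, LinearMap.comp_apply, prod_state_apply]
  simp only [← Matrix.sum_apply, ← map_sum]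
  refine congrFun (congrFun (congrArg T ?_) _) _
  ext b b'
  simp only [reindexMap_apply, prepareMap, LinearMap.coe_mk, AddHom.coe_mk, kroneckerMap_apply,
    traceRight, traceLeft, of_apply, Matrix.sum_apply, Finset.sum_mul, Equiv.prodComm_apply,
    Prod.swap]
  rw [Finset.sum_comm]
  exact Finset.sum_congr rfl fun x _ => Finset.sum_congr rfl fun r _ => mul_comm _ _

omit [DecidableEq R₁] [DecidableEq R₂] [Fintype W] [DecidableEq W] in
theorem applyMiddle_rightMap (ω₁ : CQSource X₁ B₁ R₁) (ω₂ : CQSource X₂ B₂ R₂)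
    (i j : X₂ × ((X₁ × R₁) × W) × R₂) : applyMiddle (rightMap ω₁ T) ω₂.state i j =
      applyMiddle T (ω₁.prod ω₂).state ((i.2.1.1.1, i.1), i.2.1.2, (i.2.1.1.2, i.2.2))
        ((j.2.1.1.1, j.1), j.2.1.2, (j.2.1.1.2, j.2.2)) := by
  simp only [applyMiddle, of_apply, prod_state_apply]
  rfl

/-- The reduced state on `X₁ W R₁ X₂`. -/
noncomputable def reduced (ω₁ : CQSource X₁ B₁ R₁) (ω₂ : CQSource X₂ B₂ R₂)
    (T : Matrix (B₁ × B₂) (B₁ × B₂) ℂ →ₗ[ℂ] Matrix W W ℂ) :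
    Matrix (((X₁ × W) × R₁) × X₂) (((X₁ × W) × R₁) × X₂) ℂ :=
  traceRight ((applyMiddle T (ω₁.prod ω₂).state).submatrix
    (fun i : (((X₁ × W) × R₁) × X₂) × R₂ => ((i.1.1.1.1, i.1.2), i.1.1.1.2, (i.1.1.2, i.2)))
    (fun i => ((i.1.1.1.1, i.1.2), i.1.1.1.2, (i.1.1.2, i.2))))

/-- Both inequalities have the same slack, I(R₁:X₂|X₁W), and this is nonnegative by strong
subadditivity of `reduced`. Keeping `R₁` in the output of `rightMap` is what makes the slacks
coincide. -/
theorem split_channel (ω₁ : CQSource X₁ B₁ R₁) (ω₂ : CQSource X₂ B₂ R₂) (hT : IsCPTP T) :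
    ω₁.disturbance (leftMap ω₂ T) + ω₂.disturbance (rightMap ω₁ T) ≤
        (ω₁.prod ω₂).disturbance T ∧
      (ω₁.prod ω₂).info T ≤ ω₁.info (leftMap ω₂ T) + ω₂.info (rightMap ω₁ T) := by
  have := ω₁.nonempty_R
  have := ω₂.nonempty_X
  have h₁ := hT.leftMap ω₂
  have h₂ := hT.rightMap ω₁
  set σ := applyMiddle T (ω₁.prod ω₂).state with hσ
  have pσ : σ.PosSemidef := (ω₁.prod ω₂).applyMiddle_posSemidef hT
  set τ := reduced ω₁ ω₂ T with hτ
  have pτ : τ.PosSemidef := traceRight_posSemidef (pσ.submatrix _)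
  -- Here `X₁ × W` is the conditioning system; the remaining equations identify the four entropies
  -- with those of the original and induced channels.
  have key := ssa pτ
  have eW : traceLeft (marginal12 (applyMiddle (leftMap ω₂ T) ω₁.state)) =
      traceLeft (marginal12 σ) := by
    ext i j
    simp only [traceLeft, marginal12, of_apply, applyMiddle_leftMap, Fintype.sum_prod_type]
    refine Finset.sum_congr rfl fun x _ => ?_
    rw [Finset.sum_comm]
  have eXW : traceRight (traceRight τ) = marginal12 (applyMiddle (leftMap ω₂ T) ω₁.state) := by
    ext i j
    simp only [hτ, reduced, traceRight, marginal12, of_apply, applyMiddle_leftMap, submatrix_apply]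
  have eXWR : entropy (applyMiddle (leftMap ω₂ T) ω₁.state) = entropy (traceRight τ) := by
    refine entropy_reindex (Equiv.prodAssoc X₁ W R₁).symm (fun i j => ?_)
      (traceRight_posSemidef pτ).1
    simp only [hτ, reduced, traceRight, of_apply, applyMiddle_leftMap, submatrix_apply]
    rfl
  have eσ : entropy (applyMiddle (rightMap ω₁ T) ω₂.state) = entropy σ :=
    entropy_reindex (⟨fun i => ((i.2.1.1.1, i.1), i.2.1.2, (i.2.1.1.2, i.2.2)),
      fun i => (i.1.2, ((i.1.1, i.2.2.1), i.2.1), i.2.2.2), fun _ => rfl, fun _ => rfl⟩ :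
      X₂ × ((X₁ × R₁) × W) × R₂ ≃ (X₁ × X₂) × W × R₁ × R₂)
      (fun i j => applyMiddle_rightMap ω₁ ω₂ i j) pσ.1
  have eτ : entropy (marginal12 (applyMiddle (rightMap ω₁ T) ω₂.state)) = entropy τ := by
    refine entropy_reindex (⟨fun i => (((i.2.1.1, i.2.2), i.2.1.2), i.1),
      fun i => (i.2, ((i.1.1.1, i.1.2), i.1.1.2)), fun _ => rfl, fun _ => rfl⟩ :
      X₂ × ((X₁ × R₁) × W) ≃ ((X₁ × W) × R₁) × X₂) (fun i j => ?_) pτ.1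
    simp only [marginal12, of_apply, applyMiddle_rightMap]
    rfl
  have eL : entropy (traceLeft (marginal12 (applyMiddle (rightMap ω₁ T) ω₂.state))) =
      entropy (traceRight τ) := by
    refine entropy_reindex (⟨fun i => ((i.1.1, i.2), i.1.2),
      fun i => ((i.1.1, i.2), i.1.2), fun _ => rfl, fun _ => rfl⟩ :
      (X₁ × R₁) × W ≃ (X₁ × W) × R₁) (fun i j => ?_) (traceRight_posSemidef pτ).1
    simp only [traceLeft, marginal12, of_apply, applyMiddle_rightMap]
    rfl
  have eXXW : entropy (traceRight (τ.submatrix (swapEquiv (X₁ × W) R₁ X₂).symm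
      (swapEquiv (X₁ × W) R₁ X₂).symm)) = entropy (marginal12 σ) := by
    refine entropy_reindex (⟨fun i => ((i.1.1, i.2), i.1.2), fun i => ((i.1.1, i.2), i.1.2),
      fun _ => rfl, fun _ => rfl⟩ : (X₁ × W) × X₂ ≃ (X₁ × X₂) × W) (fun i j => ?_)
      (marginal12_posSemidef pσ).1
    simp only [marginal12, of_apply, Fintype.sum_prod_type]
    rfl
  rw [eXXW, eXW] at key
  rw [ω₁.disturbance_eq h₁, ω₂.disturbance_eq h₂, (ω₁.prod ω₂).disturbance_eq hT,
    ω₁.info_eq h₁, ω₂.info_eq h₂, (ω₁.prod ω₂).info_eq hT, entropy_traceRight_prod,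
    entropy_marginal13_prod, eW, eXWR, eσ, eτ, eL, ← hσ]
  constructor <;> linarith

theorem isLUB_infoSup_prod (ω₁ : CQSource X₁ B₁ R₁) (ω₂ : CQSource X₂ B₂ R₂) {δ : ℝ}
    (hδ : 0 ≤ δ) : IsLUB {v : ℝ | ∃ δ₁ δ₂ : ℝ, 0 ≤ δ₁ ∧ 0 ≤ δ₂ ∧ δ₁ + δ₂ = δ ∧
      v = ω₁.infoSup δ₁ + ω₂.infoSup δ₂} ((ω₁.prod ω₂).infoSup δ) := by
  constructor
  · rintro v ⟨δ₁, δ₂, h₁, h₂, rfl, rfl⟩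
    exact infoSup_add_le_infoSup_prod ω₁ ω₂ h₁ h₂
  · intro c hc
    refine (ω₁.prod ω₂).infoSup_le hδ fun d T hT hd => ?_
    obtain ⟨k₁, k₂⟩ := split_channel ω₁ ω₂ hT
    have n₁ := ω₁.disturbance_nonneg (hT.leftMap ω₂)
    have n₂ := ω₂.disturbance_nonneg (hT.rightMap ω₁)
    -- The left channel is allotted exactly its own disturbance; `k₁` shows that what is left of `δ`
    -- covers the right one.
    refine (k₂.trans (add_le_add (ω₁.le_infoSup (hT.leftMap ω₂) le_rfl)
      (ω₂.le_infoSup (hT.rightMap ω₁) (δ := δ - ω₁.disturbance (leftMap ω₂ T)) ?_))).trans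
      (hc ⟨_, δ - ω₁.disturbance (leftMap ω₂ T), n₁, ?_, by ring, rfl⟩) <;> linarith

end Product

end CQSource
end QInfo

namespace QInfo

namespace CQSource

open Filter Topology

/-! ### Continuity of `infoSup`. -/

section Limit

variable {X B R : Type*} [Fintype X] [DecidableEq X] [Fintype B] [Fintype R] [DecidableEq R]

theorem infoSupTilde_le (ω : CQSource X B R) {δ : ℝ} (hδ : 0 < δ) :
    ω.infoSupTilde ≤ ω.infoSup δ := by
  refine csInf_le ⟨0, ?_⟩ ⟨δ, hδ, rfl⟩
  rintro v ⟨ε, hε, rfl⟩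
  exact ω.infoSup_nonneg (le_of_lt hε)

theorem le_infoSupTilde (ω : CQSource X B R) {c : ℝ} (h : ∀ δ > 0, c ≤ ω.infoSup δ) :
    c ≤ ω.infoSupTilde := by
  refine le_csInf ⟨_, 1, Set.mem_Ioi.mpr one_pos, rfl⟩ ?_
  rintro v ⟨ε, hε, rfl⟩
  exact h ε hε

theorem exists_infoSup_lt (ω : CQSource X B R) {c : ℝ} (h : ω.infoSupTilde < c) :
    ∃ δ > 0, ω.infoSup δ < c := by
  by_contra! hc
  exact absurd (ω.le_infoSupTilde hc) (not_le.mpr h)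

/-- A concave function can only jump at the boundary of its domain. At 0, monotonicity and the
assumed equality with the infimum exclude a jump. -/
theorem continuousOn_infoSup (ω : CQSource X B R) (h : ω.infoSup 0 = ω.infoSupTilde) :
    ContinuousOn ω.infoSup (Set.Ici 0) := by
  intro δ hδ
  rcases (Set.mem_Ici.mp hδ).eq_or_lt with rfl | hpos
  · rw [ContinuousWithinAt, tendsto_order]
    constructor
    · intro a ha
      filter_upwards [self_mem_nhdsWithin] with ε hε
      exact ha.trans_le (ω.infoSup_mono le_rfl hε)
    · intro a ha
      obtain ⟨ε, hε, hlt⟩ := ω.exists_infoSup_lt (h ▸ ha)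
      filter_upwards [self_mem_nhdsWithin, mem_nhdsWithin_of_mem_nhds (Iio_mem_nhds hε)] with η h0 h1
      exact (ω.infoSup_mono h0 (le_of_lt h1)).trans_lt hlt
  · have := ω.concaveOn_infoSup.continuousOn_interior
    rw [interior_Ici] at this
    exact (this.continuousAt (Ioi_mem_nhds hpos)).continuousWithinAt

end Limit

/-! ### Attainment, and additivity at zero disturbance. -/

section Prod

variable {X₁ B₁ R₁ X₂ B₂ R₂ : Type*}
    [Fintype X₁] [DecidableEq X₁] [Fintype B₁] [Fintype R₁] [DecidableEq R₁]
    [Fintype X₂] [DecidableEq X₂] [Fintype B₂] [Fintype R₂] [DecidableEq R₂]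

theorem isGreatest_infoSup_prod (ω₁ : CQSource X₁ B₁ R₁) (ω₂ : CQSource X₂ B₂ R₂)
    (h₁ : ω₁.infoSup 0 = ω₁.infoSupTilde) (h₂ : ω₂.infoSup 0 = ω₂.infoSupTilde) {δ : ℝ}
    (hδ : 0 ≤ δ) : IsGreatest {v : ℝ | ∃ δ₁ δ₂ : ℝ, 0 ≤ δ₁ ∧ 0 ≤ δ₂ ∧ δ₁ + δ₂ = δ ∧
      v = ω₁.infoSup δ₁ + ω₂.infoSup δ₂} ((ω₁.prod ω₂).infoSup δ) := by
  have lub := isLUB_infoSup_prod ω₁ ω₂ hδ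
  refine ⟨?_, lub.1⟩
  have c₁ : ContinuousOn (fun t => ω₁.infoSup t) (Set.Icc 0 δ) :=
    (ω₁.continuousOn_infoSup h₁).mono Set.Icc_subset_Ici_self
  have c₂ : ContinuousOn (fun t => ω₂.infoSup (δ - t)) (Set.Icc 0 δ) :=
    (ω₂.continuousOn_infoSup h₂).comp (by fun_prop) fun t ht => sub_nonneg.mpr ht.2
  -- A splitting of `δ` is a point `t` of the compact interval [0, δ], on which the sum is
  -- continuous.
  obtain ⟨t, ht, hmax⟩ := isCompact_Icc.exists_isMaxOn (Set.nonempty_Icc.mpr hδ) (c₁.add c₂)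
  have : (ω₁.prod ω₂).infoSup δ = ω₁.infoSup t + ω₂.infoSup (δ - t) := by
    refine le_antisymm (lub.2 ?_) (lub.1 ⟨t, δ - t, ht.1, sub_nonneg.mpr ht.2, by ring, rfl⟩)
    rintro v ⟨δ₁, δ₂, n₁, n₂, rfl, rfl⟩
    have := hmax (show δ₁ ∈ Set.Icc 0 (δ₁ + δ₂) from ⟨n₁, by linarith⟩)
    simpa using this
  exact ⟨t, δ - t, ht.1, sub_nonneg.mpr ht.2, by ring, this⟩

theorem infoSup_prod_zero (ω₁ : CQSource X₁ B₁ R₁) (ω₂ : CQSource X₂ B₂ R₂) :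
    (ω₁.prod ω₂).infoSup 0 = ω₁.infoSup 0 + ω₂.infoSup 0 := by
  have lub := isLUB_infoSup_prod ω₁ ω₂ le_rfl
  refine le_antisymm (lub.2 ?_) (lub.1 ⟨0, 0, le_rfl, le_rfl, by ring, rfl⟩)
  rintro v ⟨δ₁, δ₂, n₁, n₂, h, rfl⟩
  obtain rfl : δ₁ = 0 := by linarith
  obtain rfl : δ₂ = 0 := by linarith
  exact le_rfl

theorem infoSupTilde_prod (ω₁ : CQSource X₁ B₁ R₁) (ω₂ : CQSource X₂ B₂ R₂) :
    (ω₁.prod ω₂).infoSupTilde = ω₁.infoSupTilde + ω₂.infoSupTilde := by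
  refine le_antisymm (le_of_forall_pos_le_add fun ε hε => ?_)
    ((ω₁.prod ω₂).le_infoSupTilde fun δ hδ => ?_)
  · obtain ⟨δ₁, p₁, h₁⟩ := ω₁.exists_infoSup_lt (lt_add_of_pos_right _ (half_pos hε))
    obtain ⟨δ₂, p₂, h₂⟩ := ω₂.exists_infoSup_lt (lt_add_of_pos_right _ (half_pos hε))
    -- With total budget `min δ₁ δ₂`, each part of any splitting is at most `δ₁` and at most `δ₂`.
    have p : 0 < min δ₁ δ₂ := lt_min p₁ p₂
    refine ((ω₁.prod ω₂).infoSupTilde_le p).trans ((isLUB_infoSup_prod ω₁ ω₂ p.le).2 ?_)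
    rintro v ⟨η₁, η₂, n₁, n₂, h, rfl⟩
    have m₁ := ω₁.infoSup_mono n₁ (show η₁ ≤ δ₁ by linarith [min_le_left δ₁ δ₂])
    have m₂ := ω₂.infoSup_mono n₂ (show η₂ ≤ δ₂ by linarith [min_le_right δ₁ δ₂])
    linarith
  · have := infoSup_add_le_infoSup_prod ω₁ ω₂ (half_pos hδ).le (half_pos hδ).le
    rw [add_halves] at this
    linarith [ω₁.infoSupTilde_le (half_pos hδ), ω₂.infoSupTilde_le (half_pos hδ)]

end Prod

/-! ### Tensor powers. -/

section Pow

variable {X B R : Type*} [Fintype X] [DecidableEq X] [Fintype B] [Fintype R] [DecidableEq R]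

/-- The alphabet of the empty power has one letter, so S(X) = 0 bounds the information. -/
theorem infoSup_pow_zero (ω : CQSource X B R) {δ : ℝ} (hδ : 0 ≤ δ) : (ω.pow 0).infoSup δ = 0 := by
  refine le_antisymm ((ω.pow 0).infoSup_le hδ fun d T hT _ => ?_) ((ω.pow 0).infoSup_nonneg hδ)
  refine ((ω.pow 0).info_le hT).trans_eq (entropy_subsingleton
    (traceRight_posSemidef (ω.pow 0).state_posSemidef).1 ?_)
  rw [trace_traceRight, state_trace]

theorem infoSup_pow_succ (ω : CQSource X B R) (n : ℕ) {δ : ℝ} (hδ : 0 ≤ δ) :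
    (ω.pow (n + 1)).infoSup δ = (ω.prod (ω.pow n)).infoSup δ := by
  refine infoSup_reindex (Fin.consEquiv fun _ => X).symm (Fin.consEquiv fun _ => B).symm
    (Fin.consEquiv fun _ => R).symm (fun i j => ?_) hδ
  rw [pow_state_apply, prod_state_apply, pow_state_apply, Fin.prod_univ_succ]
  rfl

theorem infoSup_pow (ω : CQSource X B R) (n : ℕ) {δ : ℝ} (hδ : 0 ≤ δ) :
    (ω.pow n).infoSup (n * δ) = n * ω.infoSup δ := by
  induction n generalizing δ with
  | zero => simpa using ω.infoSup_pow_zero le_rfl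
  | succ n ih =>
    have hn : (0 : ℝ) ≤ n := n.cast_nonneg
    push_cast
    rw [ω.infoSup_pow_succ n (by positivity)]
    have lub := isLUB_infoSup_prod ω (ω.pow n) (show 0 ≤ ((n : ℝ) + 1) * δ by positivity)
    refine le_antisymm (lub.2 ?_) (lub.1 ⟨δ, n * δ, hδ, by positivity, by ring, by rw [ih hδ]; ring⟩)
    rintro v ⟨δ₁, δ₂, n₁, n₂, h, rfl⟩
    -- The share `δ₂` is distributed equally over `n` copies, which needs `n ≠ 0`.
    rcases n.eq_zero_or_pos with rfl | hpos
    · rw [ω.infoSup_pow_zero n₂]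
      have := ω.infoSup_mono n₁ (show δ₁ ≤ δ by push_cast at h; linarith)
      simpa using this
    · have hpos' : (0 : ℝ) < n := by exact_mod_cast hpos
      have hn1 : (0 : ℝ) < n + 1 := by positivity
      have e := ih (div_nonneg n₂ hn)
      rw [mul_div_cancel₀ _ hpos'.ne'] at e
      -- Concavity with weights 1/(n+1) and n/(n+1) at `δ₁` and `δ₂ / n`, whose weighted mean is
      -- `δ`.
      have conc := ω.concaveOn_infoSup.2 (Set.mem_Ici.mpr n₁)
        (Set.mem_Ici.mpr (div_nonneg n₂ hn)) (show 0 ≤ 1 / ((n : ℝ) + 1) by positivity)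
        (show 0 ≤ (n : ℝ) / (n + 1) by positivity) (by field_simp; ring)
      simp only [smul_eq_mul] at conc
      have e2 : 1 / ((n : ℝ) + 1) * δ₁ + n / (n + 1) * (δ₂ / n) = δ := by
        field_simp
        linarith
      rw [e2] at conc
      have := mul_le_mul_of_nonneg_left conc hn1.le
      rw [e]
      refine le_trans (le_of_eq ?_) this
      field_simp

end Pow

end CQSource

end QInfo

theorem mainTheorem9
    {X B R X₁ B₁ R₁ X₂ B₂ R₂ : Type*}
    [Fintype X] [DecidableEq X] [Fintype B] [Fintype R] [DecidableEq R]
    [Fintype X₁] [DecidableEq X₁] [Fintype B₁] [Fintype R₁] [DecidableEq R₁]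
    [Fintype X₂] [DecidableEq X₂] [Fintype B₂] [Fintype R₂] [DecidableEq R₂]
    (ω : QInfo.CQSource X B R)
    (ω₁ : QInfo.CQSource X₁ B₁ R₁) (ω₂ : QInfo.CQSource X₂ B₂ R₂) :
    (∀ δ : ℝ, 0 ≤ δ →
      IsLUB {v : ℝ | ∃ δ₁ δ₂ : ℝ, 0 ≤ δ₁ ∧ 0 ≤ δ₂ ∧ δ₁ + δ₂ = δ ∧
        v = ω₁.infoSup δ₁ + ω₂.infoSup δ₂} ((ω₁.prod ω₂).infoSup δ)) ∧
    (ω₁.infoSup 0 = ω₁.infoSupTilde → ω₂.infoSup 0 = ω₂.infoSupTilde →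
      ∀ δ : ℝ, 0 ≤ δ →
        IsGreatest {v : ℝ | ∃ δ₁ δ₂ : ℝ, 0 ≤ δ₁ ∧ 0 ≤ δ₂ ∧ δ₁ + δ₂ = δ ∧
          v = ω₁.infoSup δ₁ + ω₂.infoSup δ₂} ((ω₁.prod ω₂).infoSup δ)) ∧
    (∀ (n : ℕ) (δ : ℝ), 0 ≤ δ → (ω.pow n).infoSup (n * δ) = n * ω.infoSup δ) ∧
    (ω₁.prod ω₂).infoSup 0 = ω₁.infoSup 0 + ω₂.infoSup 0 ∧
    (ω₁.prod ω₂).infoSupTilde = ω₁.infoSupTilde + ω₂.infoSupTilde := by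
  exact ⟨fun δ hδ => QInfo.CQSource.isLUB_infoSup_prod ω₁ ω₂ hδ,
    fun h₁ h₂ δ hδ => QInfo.CQSource.isGreatest_infoSup_prod ω₁ ω₂ h₁ h₂ hδ,
    fun n δ hδ => ω.infoSup_pow n hδ, QInfo.CQSource.infoSup_prod_zero ω₁ ω₂,
    QInfo.CQSource.infoSupTilde_prod ω₁ ω₂⟩
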